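/- Let $G$ be a connected finite graph (loops and multiple edges allowed) with edge set $E$. A set of edges is called a cycle if it consists of distinct edges $e_1,\dots,e_n$ ($n\ge 1$), where $e_i$ joins $v_i$ to $v_{i+1}$ for distinct vertices $v_1,\dots,v_n$ and $v_{n+1}:=v_1$; directing all $e_i$ from $v_i$ to $v_{i+1}$, or all from $v_{i+1}$ to $v_i$, gives the two directed cycles on it (a loop has two directions). A cocycle is an inclusion-minimal nonempty cut, a cut being the set of edges between a vertex set $W$ and its complement; directing all its edges from $W$ to the complement, or all the other way, gives the two directed cocycles on it. Fix a reference orientation, and write directed cycles and cocycles as $\{0,\pm1\}$-vectors in $\mathbb{R}^E$. A cycle signature $\sigma$ chooses a directed cycle $\sigma(C)$ on each cycle $C$; it is acyclic if $\sum_C a_C\sigma(C)=0$ with all $a_C\ge 0$ implies that all $a_C=0$. An orientation is $\sigma$-compatible if every directed cycle in it is one of the $\sigma(C)$. Acyclic cocycle signatures $\sigma^*$ and $\sigma^*$-compatible orientations are defined in the same way with cocycles in place of cycles. An orientation is $(\sigma,\sigma^*)$-compatible if it is both $\sigma$- and $\sigma^*$-compatible. Fix an acyclic cycle signature $\sigma$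 and an acyclic cocycle signature $\sigma^*$ of $G$. For a spanning tree $T$ let $g_{\sigma,\sigma^*}(T)$ be the orientation in which each $e\notin T$ is directed as in $\sigma(C)$, where $C$ is the unique cycle in $T\cup\{e\}$, and each $e\in T$ is directed as in $\sigma^*(C^*)$, where $C^*$ is the unique cocycle in $(E\setminus T)\cup\{e\}$. If an orientation $O$ is obtained from a $(\sigma,\sigma^*)$-compatible orientation $O^{cp}=g_{\sigma,\sigma^*}(T)$ by reversing pairwise disjoint directed cycles $\{\vec C_i\}_{i\in I}$ and directed cocycles $\{\vec C_j^*\}_{j\in J}$ in $O^{cp}$, with underlying edge sets $C_i$ and $C_j^*$, put $$\varphi_{\sigma,\sigma^*}(O)=\Big(T\cup\bigcup_{i\in I}C_i\Big)\setminus\bigcup_{j\in J}C_j^*.$$ Then this defines a map $\varphi_{\sigma,\sigma^*}$ from the set of all orientations of $G$ to the set of all subsets of $E$ (every orientation $O$ arises in this way, and the value does not depend on the choices), this map is a bijection, and it is locally bijective in the following sense. (1) Let $O_P$ be an orientation of a subset $P\subseteq E$. Then the map $$\{\text{orientations of }E\setminus P\}\to\{\text{subsets of }E\setminus P\},\qquad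 O_{E\setminus P}\mapsto \varphi_{\sigma,\sigma^*}(O_{E\setminus P}\cup O_P)\setminus P$$ is a bijection. (2) Let $E_c$ and $E_d$ be two disjoint subsets of $E$. Then the map $$\{\text{subsets of }E\setminus(E_c\cup E_d)\}\to\{\text{orientations of }E\setminus(E_c\cup E_d)\},\qquad H\mapsto \varphi^{-1}_{\sigma,\sigma^*}(H\cup E_c)\big|_{E\setminus(E_c\cup E_d)}$$ is a bijection. -/

import Mathlib

/-- A graph with vertex set `V` and edge set `E` (loops and multiple edges are allowed),
together with a reference orientation: in the reference orientation the edge `e` is the arc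
from `tail e` to `head e`. -/
structure RefGraph (V E : Type*) where
  tail : E → V
  head : E → V

/-- The total orientations of the edges in `E`: the value at `e` is `1` if `e` is directed as
in the reference orientation, and `-1` if it is directed the other way. (A loop also has two
directions.) An orientation of a set `A` of edges is an element of `EdgeOrientation A`. -/
abbrev EdgeOrientation (E : Type*) := E → ℤˣ

namespace RefGraph

variable {V E : Type*} (G : RefGraph V E)

/-- The tail of the arc obtained by giving the edge `e` the direction `s`. -/
def arcTail (e : E) (s : ℤˣ) : V := if s = 1 then G.tail e else G.head e

/-- The head of the arc obtained by giving the edge `e` the direction `s`. -/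
def arcHead (e : E) (s : ℤˣ) : V := if s = 1 then G.head e else G.tail e

/-- The edge `e` has endpoints `u` and `w`. -/
def Joins (e : E) (u w : V) : Prop :=
  (G.tail e = u ∧ G.head e = w) ∨ (G.tail e = w ∧ G.head e = u)

/-- The spanning subgraph with edge set `S` is connected. Only the adjacency of distinct
vertices matters for this, so connectivity is that of the underlying simple graph. -/
def ConnectedOn (S : Set E) : Prop :=
  (SimpleGraph.fromRel (fun u w : V => ∃ e ∈ S, G.Joins e u w)).Connected

/-- The graph is connected. -/
def IsConnected : Prop := G.ConnectedOn Set.univ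

/-- `C` is a cycle: the set of `n + 1` distinct edges `ε i` joining `v i` and `v (i + 1)`, where
`v 0, …, v n` are distinct vertices and the indices are read cyclically (addition in
`Fin (n + 1)`). The case `n = 0` is a loop, `n = 1` a pair of parallel edges. -/
def IsCycle (C : Set E) : Prop :=
  ∃ (n : ℕ) (v : Fin (n + 1) → V) (ε : Fin (n + 1) → E),
    Function.Injective v ∧ Function.Injective ε ∧
    (∀ i, G.Joins (ε i) (v i) (v (i + 1))) ∧ C = Set.range ε

/-- `c` is a directed cycle, written as a `{0, 1, -1}`-vector with respect to the reference
orientation: every edge `ε i` of a cycle is directed from `v i` to `v (i + 1)`. -/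
def IsDirectedCycle (c : E → ℤ) : Prop :=
  ∃ (n : ℕ) (v : Fin (n + 1) → V) (ε : Fin (n + 1) → E) (s : Fin (n + 1) → ℤˣ),
    Function.Injective v ∧ Function.Injective ε ∧
    (∀ i, G.arcTail (ε i) (s i) = v i ∧ G.arcHead (ε i) (s i) = v (i + 1)) ∧
    (∀ i, c (ε i) = (s i : ℤ)) ∧ (∀ e, e ∉ Set.range ε → c e = 0)

/-- The cut of `W`: the edges with one endpoint in `W` and the other one not in `W`. -/
def cut (W : Set V) : Set E :=
  {e | (G.tail e ∈ W ∧ G.head e ∉ W) ∨ (G.tail e ∉ W ∧ G.head e ∈ W)}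

/-- A cocycle is a nonempty cut which is minimal for inclusion among the nonempty cuts. -/
def IsCocycle (D : Set E) : Prop :=
  Minimal (fun A : Set E => A.Nonempty ∧ ∃ W : Set V, A = G.cut W) D

open scoped Classical in
/-- `c` is a directed cocycle, written as a `{0, 1, -1}`-vector with respect to the reference
orientation: every edge of a cocycle `cut W` is directed from `W` to its complement. (For the
other direction, replace `W` by its complement.) -/
def IsDirectedCocycle (c : E → ℤ) : Prop :=
  ∃ W : Set V, G.IsCocycle (G.cut W) ∧ ∀ e,
    c e = if G.tail e ∈ W ∧ G.head e ∉ W then 1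
      else if G.tail e ∉ W ∧ G.head e ∈ W then -1 else 0

/-- `T` is (the edge set of) a spanning tree: connected, spanning, and without cycles. -/
def IsSpanningTree (T : Set E) : Prop :=
  G.ConnectedOn T ∧ ∀ C, G.IsCycle C → ¬ C ⊆ T

/-- A cycle signature: the choice of a direction for each cycle. -/
structure CycleSignature where
  dir : {C : Set E // G.IsCycle C} → E → ℤ
  isDirectedCycle : ∀ C, G.IsDirectedCycle (dir C)
  support_dir : ∀ C, Function.support (dir C) = C.1

/-- A cocycle signature: the choice of a direction for each cocycle. -/
structure CocycleSignature where
  dir : {D : Set E // G.IsCocycle D} → E → ℤ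
  isDirectedCocycle : ∀ D, G.IsDirectedCocycle (dir D)
  support_dir : ∀ D, Function.support (dir D) = D.1

/-- The directed cycle or cocycle `c` is in the orientation `O`. -/
def IsIn (c : E → ℤ) (O : EdgeOrientation E) : Prop := ∀ e, c e ≠ 0 → c e = (O e : ℤ)

variable {G}

open scoped Classical in
/-- Acyclic cycle signature: no nontrivial nonnegative real combination of the chosen directed
cycles vanishes in `ℝ^E`. -/
def CycleSignature.IsAcyclic [Fintype E] (σ : G.CycleSignature) : Prop :=
  ∀ a : {C : Set E // G.IsCycle C} → ℝ, (∀ C, 0 ≤ a C) →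
    (∀ e, ∑ C, a C * (σ.dir C e : ℝ) = 0) → ∀ C, a C = 0

open scoped Classical in
/-- Acyclic cocycle signature: no nontrivial nonnegative real combination of the chosen directed
cocycles vanishes in `ℝ^E`. -/
def CocycleSignature.IsAcyclic [Fintype E] (σ' : G.CocycleSignature) : Prop :=
  ∀ a : {D : Set E // G.IsCocycle D} → ℝ, (∀ D, 0 ≤ a D) →
    (∀ e, ∑ D, a D * (σ'.dir D e : ℝ) = 0) → ∀ D, a D = 0

/-- `O` is `σ`-compatible: every directed cycle in `O` is one of those chosen by `σ`. -/
def CycleSignature.Compatible (σ : G.CycleSignature) (O : EdgeOrientation E) : Prop :=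
  ∀ c, G.IsDirectedCycle c → IsIn c O → c ∈ Set.range σ.dir

/-- `O` is `σ'`-compatible: every directed cocycle in `O` is one of those chosen by `σ'`. -/
def CocycleSignature.Compatible (σ' : G.CocycleSignature) (O : EdgeOrientation E) : Prop :=
  ∀ c, G.IsDirectedCocycle c → IsIn c O → c ∈ Set.range σ'.dir

/-- For a spanning tree `T`, the orientation `O` is the image of `T` under the geometric
bijection: each `e ∉ T` is directed as in `σ (C)` for the fundamental cycle `C` of `e`, which is
the unique cycle contained in `T ∪ {e}`, and each `e ∈ T` is directed as in `σ' (D)` for the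
fundamental cocycle `D` of `e`, which is the unique cocycle contained in `(E ∖ T) ∪ {e}`. -/
def IsGeometricImage (σ : G.CycleSignature) (σ' : G.CocycleSignature)
    (T : Set E) (O : EdgeOrientation E) : Prop :=
  (∀ e, e ∉ T → ∃ C : {C : Set E // G.IsCycle C}, C.1 ⊆ insert e T ∧ (O e : ℤ) = σ.dir C e) ∧
  (∀ e, e ∈ T → ∃ D : {D : Set E // G.IsCocycle D}, D.1 ⊆ insert e Tᶜ ∧ (O e : ℤ) = σ'.dir D e)

/-- The union of the underlying edge sets of a family of directed cycles or cocycles. -/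
def edgesOf (F : Set (E → ℤ)) : Set E := ⋃ c ∈ F, Function.support c

open scoped Classical in
/-- The orientation obtained from `O` by reversing the edges in `A`. -/
noncomputable def reverseOn (A : Set E) (O : EdgeOrientation E) : EdgeOrientation E :=
  fun e => if e ∈ A then - O e else O e

/-- The defining relation of the map `φ`: the orientation `O` is obtained from a
`(σ, σ')`-compatible orientation `Ocp` by reversing disjoint directed cycles (the family `𝒞`)
and directed cocycles (the family `𝒟`) in `Ocp`, the spanning tree `T` is the preimage of `Ocp`
under the geometric bijection, and `S` is obtained from `T` by adding the edges of the reversed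
cycles and deleting the edges of the reversed cocycles. -/
def IsPhiImage (σ : G.CycleSignature) (σ' : G.CocycleSignature)
    (O : EdgeOrientation E) (S : Set E) : Prop :=
  ∃ (Ocp : EdgeOrientation E) (𝒞 𝒟 : Set (E → ℤ)) (T : Set E),
    σ.Compatible Ocp ∧ σ'.Compatible Ocp ∧
    (∀ c ∈ 𝒞, G.IsDirectedCycle c ∧ IsIn c Ocp) ∧
    (∀ d ∈ 𝒟, G.IsDirectedCocycle d ∧ IsIn d Ocp) ∧
    𝒞.PairwiseDisjoint Function.support ∧ 𝒟.PairwiseDisjoint Function.support ∧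
    Disjoint (edgesOf 𝒞) (edgesOf 𝒟) ∧
    O = reverseOn (edgesOf 𝒞 ∪ edgesOf 𝒟) Ocp ∧
    G.IsSpanningTree T ∧ IsGeometricImage σ σ' T Ocp ∧
    S = (T ∪ edgesOf 𝒞) \ edgesOf 𝒟

/-- The map `φ` from orientations to spanning subgraphs (given by their edge sets): the subgraph
related to `O` by `IsPhiImage`. -/
noncomputable def phi (σ : G.CycleSignature) (σ' : G.CocycleSignature)
    (O : EdgeOrientation E) : Set E :=
  Classical.epsilon (fun S => IsPhiImage σ σ' O S)

end RefGraph

open scoped Classical in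
/-- The orientation `oP ∪ o` of `E`, for an orientation `oP` of `P` and `o` of `E ∖ P`. -/
noncomputable def glueOrientation {E : Type*} (P : Set E)
    (oP : EdgeOrientation P) (o : EdgeOrientation (Pᶜ : Set E)) : EdgeOrientation E :=
  fun e => if h : e ∈ P then oP ⟨e, h⟩ else o ⟨e, h⟩

/-! ### Theorems of the alternative and orthogonal subspaces of `ℝ^E` -/

section LinearAlgebra

open Matrix

/-! By Gordan's theorem an acyclic signature is induced by a weight: there are `w`, `w'` with
nonzero product on every directed cycle, respectively cocycle, such that the chosen ones are exactly
those of positive product. The rest takes place in the cycle space `U` and the cut space `U'`,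
orthogonal complements of each other whose roles can be exchanged. A family of disjoint directed
cycles in an orientation is recorded by its sum, a `{0, 1, -1}`-vector of `U`; likewise for cocycles
and `U'`.

Existence: given `O`, let `z` and `y` minimize `w` and `w'` among such vectors of `U` and `U'` in
`O`. Reversing both gives a compatible orientation `g`, since a cycle or cocycle of `g` with the
wrong sign would improve the minimum. Compatibility makes `w` and `w'` nonnegative on the vectors of
`U` and `U'` in the orthant of `g`, so linear programming duality
(`OrthogonalPair.exists_complementary`) yields `p ∈ w + U'` and `q ∈ w' + U` in this orthant with
disjoint supports. As the weights vanish on no circuit, the support of `q` is a spanning tree `T`,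
and the signs of `p` and `q` say that `g` is the geometric image of `T`.

Uniqueness: everything else follows from one statement, `IsPhiImage.eq_and_eq`: if `S₁` and `S₂`
agree at each edge where `O₁` and `O₂` differ, then `O₁ = O₂` and `S₁ = S₂`. For its proof,
orthogonality makes certain sums vanish while the agreement makes all their terms nonnegative; this
identifies first the reversed vectors (`ReversalDatum.Agree.z_eq`), then the trees
(`ReversalDatum.Agree.T_subset`). Taking `O₁ = O₂` gives well-definedness, `S₁ = S₂` gives
injectivity, and the mixed cases give injectivity of both local maps. Surjectivity is a count, there
being as many orientations as subsets of a finite set. -/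

/-- **Farkas' lemma**: a linear functional that is nonnegative wherever finitely many functionals
are nonnegative is a nonnegative combination of these. -/
theorem exists_nonneg_combination {X ι : Type*} [AddCommGroup X] [Module ℝ X] (s : Finset ι)
    (f : ι → X →ₗ[ℝ] ℝ) (g : X →ₗ[ℝ] ℝ)
    (h : ∀ x, (∀ i ∈ s, 0 ≤ f i x) → 0 ≤ g x) :
    ∃ a : ι → ℝ, (∀ i, 0 ≤ a i) ∧ ∀ x, g x = ∑ i ∈ s, a i * f i x := by
  classical
  induction s using Finset.induction_on generalizing f g with
  | empty =>
    refine ⟨0, fun _ => le_rfl, fun x => ?_⟩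
    have h1 := h x (by simp)
    have h2 := h (-x) (by simp)
    rw [map_neg] at h2
    simp only [Finset.sum_empty]
    linarith
  | insert j s hj ih =>
    -- If the constraint `f j` is superfluous, it gets coefficient `0`. Otherwise some `x₁` violates
    -- only `f j` among the constraints, and it serves as a direction of projection onto the kernel
    -- of `f j`.
    by_cases hs : ∀ x, (∀ i ∈ s, 0 ≤ f i x) → 0 ≤ g x
    · obtain ⟨a, ha, hg⟩ := ih f g hs
      refine ⟨Function.update a j 0, fun i => ?_, fun x => ?_⟩
      · by_cases hi : i = j
        · simp [hi]
        · simp [hi, ha i]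
      · rw [hg, Finset.sum_insert hj, Function.update_self, zero_mul, zero_add]
        refine Finset.sum_congr rfl fun i hi => ?_
        rw [Function.update_of_ne (ne_of_mem_of_not_mem hi hj)]
    · push Not at hs
      obtain ⟨x₁, hx₁, hgx₁⟩ := hs
      have hfx₁ : f j x₁ < 0 := by
        by_contra hcon
        refine absurd (h x₁ fun i hi => ?_) (not_le.2 hgx₁)
        rcases Finset.mem_insert.1 hi with rfl | hi
        · exact not_lt.1 hcon
        · exact hx₁ i hi
      set x₀ : X := (-(f j x₁))⁻¹ • x₁ with hx₀def
      have hpos : 0 < (-(f j x₁))⁻¹ := inv_pos.2 (by linarith)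
      have hx₀ : ∀ i ∈ s, 0 ≤ f i x₀ := fun i hi => by
        rw [hx₀def, map_smul, smul_eq_mul]
        exact mul_nonneg hpos.le (hx₁ i hi)
      have hgx₀ : g x₀ < 0 := by
        rw [hx₀def, map_smul, smul_eq_mul]
        exact mul_neg_of_pos_of_neg hpos hgx₁
      have hfx₀ : f j x₀ = -1 := by
        rw [hx₀def, map_smul, smul_eq_mul]
        have : f j x₁ ≠ 0 := hfx₁.ne
        field_simp
      -- These are `f i` and `g` composed with the projection `x ↦ x + f j x • x₀`, whose image lies
      -- in the kernel of `f j` because `f j x₀ = -1`.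
      obtain ⟨a, ha, hg⟩ := ih (fun i => f i + f i x₀ • f j) (g + g x₀ • f j) (fun x hx => by
        have := h (x + f j x • x₀) (fun i hi => by
          rcases Finset.mem_insert.1 hi with rfl | hi
          · simp [hfx₀]
          · have := hx i hi
            simp only [LinearMap.add_apply, LinearMap.smul_apply, smul_eq_mul] at this
            simp only [map_add, map_smul, smul_eq_mul]
            linarith)
        simp only [map_add, map_smul, smul_eq_mul] at this
        simp only [LinearMap.add_apply, LinearMap.smul_apply, smul_eq_mul]
        linarith)
      refine ⟨Function.update a j ((∑ i ∈ s, a i * f i x₀) - g x₀), fun i => ?_, fun x => ?_⟩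
      · by_cases hi : i = j
        · subst hi
          rw [Function.update_self]
          have := Finset.sum_nonneg fun i hi => mul_nonneg (ha i) (hx₀ i hi)
          linarith
        · simp [hi, ha i]
      · rw [Finset.sum_insert hj, Function.update_self]
        have h1 := hg x
        simp only [LinearMap.add_apply, LinearMap.smul_apply, smul_eq_mul, mul_add,
          Finset.sum_add_distrib] at h1
        have h2 : ∑ i ∈ s, Function.update a j ((∑ i ∈ s, a i * f i x₀) - g x₀) i * f i x =
            ∑ i ∈ s, a i * f i x :=
          Finset.sum_congr rfl fun i hi => by
            rw [Function.update_of_ne (ne_of_mem_of_not_mem hi hj)]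
        rw [h2, sub_mul, Finset.sum_mul]
        have h3 : ∑ i ∈ s, a i * (f i x₀ * f j x) = ∑ i ∈ s, a i * f i x₀ * f j x :=
          Finset.sum_congr rfl fun i _ => by ring
        linarith

variable {E : Type*} [Fintype E]

/-- **Gordan's theorem**: finitely many vectors without nontrivial vanishing nonnegative
combination lie in an open half-space. -/
theorem exists_dotProduct_pos {ι : Type*} [Fintype ι] (v : ι → E → ℝ)
    (h : ∀ a : ι → ℝ, (∀ i, 0 ≤ a i) → (∀ e, ∑ i, a i * v i e = 0) → ∀ i, a i = 0) :
    ∃ w : E → ℝ, ∀ i, 0 < w ⬝ᵥ v i := by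
  classical
  -- It suffices to be positive on one `v j` at a time and then to add up. If this fails for `j`,
  -- Farkas' lemma writes `-v j` as a nonnegative combination, which is a vanishing combination with
  -- coefficient at least `1` at `j`.
  have key : ∀ j, ∃ w : E → ℝ, (∀ i, 0 ≤ w ⬝ᵥ v i) ∧ 0 < w ⬝ᵥ v j := by
    intro j
    by_contra hcon
    push Not at hcon
    let F : ι → (E → ℝ) →ₗ[ℝ] ℝ := fun i =>
      { toFun := fun w => w ⬝ᵥ v i
        map_add' := fun x y => add_dotProduct x y (v i)
        map_smul' := fun c x => smul_dotProduct c x (v i) }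
    obtain ⟨a, ha, hg⟩ := exists_nonneg_combination Finset.univ F (-F j) (fun x hx => by
      have := hcon x (fun i => hx i (Finset.mem_univ i))
      simpa [F] using this)
    have h1 := h (fun i => a i + if i = j then 1 else 0)
      (fun i => add_nonneg (ha i) (by split_ifs <;> norm_num)) (fun e => by
        have := hg (Pi.single e 1)
        simp only [F, LinearMap.neg_apply, LinearMap.coe_mk, AddHom.coe_mk,
          single_one_dotProduct] at this
        simp only [add_mul, Finset.sum_add_distrib, ite_mul, one_mul, zero_mul,
          Finset.sum_ite_eq', Finset.mem_univ, if_true]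
        linarith) j
    simp only [if_true] at h1
    linarith [ha j]
  choose w hw hpos using key
  refine ⟨∑ j, w j, fun i => ?_⟩
  rw [sum_dotProduct]
  exact Finset.sum_pos' (fun j _ => hw j i) ⟨i, Finset.mem_univ i, hpos i⟩

/-- Two subspaces of `ℝ^E` which are the orthogonal complements of each other. -/
structure OrthogonalPair (U U' : Submodule ℝ (E → ℝ)) : Prop where
  mem_left : ∀ x, (∀ y ∈ U', x ⬝ᵥ y = 0) → x ∈ U
  mem_right : ∀ y, (∀ x ∈ U, x ⬝ᵥ y = 0) → y ∈ U'
  dotProduct_eq_zero : ∀ x ∈ U, ∀ y ∈ U', x ⬝ᵥ y = 0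

namespace OrthogonalPair

variable {U U' : Submodule ℝ (E → ℝ)}

theorem symm (h : OrthogonalPair U U') : OrthogonalPair U' U where
  mem_left x hx := h.mem_right x fun y hy => by rw [dotProduct_comm]; exact hx y hy
  mem_right y hy := h.mem_left y fun x hx => by rw [dotProduct_comm]; exact hy x hx
  dotProduct_eq_zero x hx y hy := by
    rw [dotProduct_comm]; exact h.dotProduct_eq_zero y hy x hx

/-- Strong linear programming duality, in the form of complementary slackness: if `w` and `w'`
are nonnegative on the vectors of `U` and `U'` in the orthant `o`, then `w + U'` and `w' + U`
contain vectors of the orthant `o` with disjoint supports. -/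
theorem exists_complementary (hU : OrthogonalPair U U') (w w' o : E → ℝ)
    (ho : ∀ e, o e * o e = 1)
    (hw : ∀ u ∈ U, (∀ e, 0 ≤ o e * u e) → 0 ≤ w ⬝ᵥ u)
    (hw' : ∀ u ∈ U', (∀ e, 0 ≤ o e * u e) → 0 ≤ w' ⬝ᵥ u) :
    ∃ p q : E → ℝ, p - w ∈ U' ∧ q - w' ∈ U ∧ (∀ e, 0 ≤ o e * p e) ∧ (∀ e, 0 ≤ o e * q e) ∧
      ∀ e, p e * q e = 0 := by
  classical
  by_contra hcon
  -- The system for `p = w + y / t` and `q = w' + u / t`, made homogeneous by the variable `t ≥ 0`.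
  -- The last functional encodes `p ⬝ᵥ q ≤ 0`, linear because `y ⬝ᵥ u = 0`; in a common orthant it
  -- forces `p e * q e = 0` for all `e`. As no solution has `t > 0`, Farkas' lemma applies to `-t`.
  let F : (E ⊕ E) ⊕ Bool → (U' × U × ℝ) →ₗ[ℝ] ℝ := fun i =>
    match i with
    | .inl (.inl e) =>
      { toFun := fun x => o e * (x.2.2 * w e + (x.1 : E → ℝ) e)
        map_add' := fun x y => by simp; ring
        map_smul' := fun c x => by simp; ring }
    | .inl (.inr e) =>
      { toFun := fun x => o e * (x.2.2 * w' e + (x.2.1 : E → ℝ) e)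
        map_add' := fun x y => by simp; ring
        map_smul' := fun c x => by simp; ring }
    | .inr true =>
      { toFun := fun x => x.2.2
        map_add' := fun x y => by simp
        map_smul' := fun c x => by simp }
    | .inr false =>
      { toFun := fun x => -(x.2.2 * (w ⬝ᵥ w') + w ⬝ᵥ (x.2.1 : E → ℝ) + (x.1 : E → ℝ) ⬝ᵥ w')
        map_add' := fun x y => by simp; ring
        map_smul' := fun c x => by simp; ring }
  obtain ⟨a, ha, hg⟩ := exists_nonneg_combination Finset.univ F (-F (.inr true)) (by
    rintro ⟨⟨y, hy⟩, ⟨u, hu⟩, t⟩ hx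
    by_contra ht
    have ht : 0 < t := by simpa [F] using ht
    have ht' : 0 < t⁻¹ := inv_pos.2 ht
    have key : ∀ v z : E → ℝ, ∀ e, 0 ≤ o e * (t * v e + z e) → 0 ≤ o e * (v + t⁻¹ • z) e := by
      intro v z e h
      have h2 : o e * (v + t⁻¹ • z) e = t⁻¹ * (o e * (t * v e + z e)) := by
        have : t⁻¹ * t = 1 := inv_mul_cancel₀ ht.ne'
        simp only [Pi.add_apply, Pi.smul_apply, smul_eq_mul]
        linear_combination (-(o e * v e)) * this
      rw [h2]
      exact mul_nonneg ht'.le h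
    have h1 : ∀ e, 0 ≤ o e * (w + t⁻¹ • y) e := fun e =>
      key w y e (hx (.inl (.inl e)) (Finset.mem_univ _))
    have h2 : ∀ e, 0 ≤ o e * (w' + t⁻¹ • u) e := fun e =>
      key w' u e (hx (.inl (.inr e)) (Finset.mem_univ _))
    refine hcon ⟨w + t⁻¹ • y, w' + t⁻¹ • u, ?_, ?_, h1, h2, ?_⟩
    · simpa using U'.smul_mem _ hy
    · simpa using U.smul_mem _ hu
    · have h3 : ∀ e, 0 ≤ (w + t⁻¹ • y) e * (w' + t⁻¹ • u) e := fun e => by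
        have h4 := mul_nonneg (h1 e) (h2 e)
        have : o e * (w + t⁻¹ • y) e * (o e * (w' + t⁻¹ • u) e) =
          (o e * o e) * ((w + t⁻¹ • y) e * (w' + t⁻¹ • u) e) := by ring
        rwa [this, ho, one_mul] at h4
      have h5 := hx (.inr false) (Finset.mem_univ _)
      simp only [F, LinearMap.coe_mk, AddHom.coe_mk] at h5
      have h6 : (w + t⁻¹ • y) ⬝ᵥ (w' + t⁻¹ • u) ≤ 0 := by
        have h7 : y ⬝ᵥ u = 0 := hU.symm.dotProduct_eq_zero y hy u hu
        have h8 : (w + t⁻¹ • y) ⬝ᵥ (w' + t⁻¹ • u) =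
            t⁻¹ * (t * (w ⬝ᵥ w') + w ⬝ᵥ u + y ⬝ᵥ w') := by
          have : t⁻¹ * t = 1 := inv_mul_cancel₀ ht.ne'
          simp only [add_dotProduct, dotProduct_add, smul_dotProduct, dotProduct_smul, h7,
            smul_eq_mul]
          linear_combination (-(w ⬝ᵥ w')) * this
        rw [h8]
        nlinarith
      have h7 := (Finset.sum_eq_zero_iff_of_nonneg (fun e _ => h3 e)).1
        (le_antisymm h6 (Finset.sum_nonneg fun e _ => h3 e))
      exact fun e => h7 e (Finset.mem_univ e))
  set γ := a (.inr false) with hγ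
  set A : E → ℝ := fun e => a (.inl (.inl e)) * o e with hA
  set B : E → ℝ := fun e => a (.inl (.inr e)) * o e with hB
  have hg' : ∀ y ∈ U', ∀ u ∈ U, ∀ t : ℝ, -t = t * (A ⬝ᵥ w) + A ⬝ᵥ y + (t * (B ⬝ᵥ w') + B ⬝ᵥ u)
      - γ * (t * (w ⬝ᵥ w') + w ⬝ᵥ u + y ⬝ᵥ w') + a (.inr true) * t := by
    intro y hy u hu t
    have := hg (⟨y, hy⟩, ⟨u, hu⟩, t)
    simp only [F, LinearMap.neg_apply, LinearMap.coe_mk, AddHom.coe_mk, Fintype.sum_sum_type,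
      Fintype.sum_bool] at this
    rw [this]
    have h1 : ∑ e, a (.inl (.inl e)) * (o e * (t * w e + y e)) = t * (A ⬝ᵥ w) + A ⬝ᵥ y := by
      simp only [hA, dotProduct, Finset.mul_sum, ← Finset.sum_add_distrib]
      exact Finset.sum_congr rfl fun e _ => by ring
    have h2 : ∑ e, a (.inl (.inr e)) * (o e * (t * w' e + u e)) = t * (B ⬝ᵥ w') + B ⬝ᵥ u := by
      simp only [hB, dotProduct, Finset.mul_sum, ← Finset.sum_add_distrib]
      exact Finset.sum_congr rfl fun e _ => by ring
    rw [h1, h2]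
    ring
  -- The identity `hg'` is separated into its parts in `y`, `u` and `t`.
  have hAU : A - γ • w' ∈ U := hU.mem_left _ fun y hy => by
    have := hg' y hy 0 U.zero_mem 0
    simp only [dotProduct_zero] at this
    rw [sub_dotProduct, smul_dotProduct, smul_eq_mul, dotProduct_comm w' y]
    linarith
  have hBU : B - γ • w ∈ U' := hU.mem_right _ fun u hu => by
    have := hg' 0 U'.zero_mem u hu 0
    simp only [dotProduct_zero, zero_dotProduct] at this
    rw [dotProduct_comm, sub_dotProduct, smul_dotProduct, smul_eq_mul]
    linarith
  have hneg : A ⬝ᵥ w + B ⬝ᵥ w' - γ * (w ⬝ᵥ w') < 0 := by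
    have := hg' 0 U'.zero_mem 0 U.zero_mem 1
    simp only [dotProduct_zero, zero_dotProduct] at this
    linarith [ha (.inr true)]
  have hoA : ∀ e, o e * A e = a (.inl (.inl e)) := fun e => by
    rw [hA, mul_comm, mul_assoc, ho, mul_one]
  have hoB : ∀ e, o e * B e = a (.inl (.inr e)) := fun e => by
    rw [hB, mul_comm, mul_assoc, ho, mul_one]
  have hAB : 0 ≤ A ⬝ᵥ B := Finset.sum_nonneg fun e _ => by
    have h1 : A e * B e = (o e * o e) * (A e * B e) := by rw [ho, one_mul]
    have h2 : A e * B e = (o e * A e) * (o e * B e) := by rw [h1]; ring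
    rw [h2, hoA, hoB]
    exact mul_nonneg (ha _) (ha _)
  -- Expanded, this reads `A ⬝ᵥ B = γ * (A ⬝ᵥ w + B ⬝ᵥ w' - γ * (w ⬝ᵥ w'))`, which is negative for
  -- `γ > 0`, against `hAB`. For `γ = 0`, the vectors `A` and `B` themselves lie in `U` and `U'`,
  -- and `hneg` contradicts the sign hypotheses on `w` and `w'`.
  have horth := hU.dotProduct_eq_zero _ hAU _ hBU
  simp only [sub_dotProduct, dotProduct_sub, smul_dotProduct, dotProduct_smul, smul_eq_mul]
    at horth
  rw [dotProduct_comm w' B, dotProduct_comm w' w] at horth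
  rcases (ha (.inr false)).lt_or_eq with h0 | h0
  · have h0 : 0 < γ := h0
    nlinarith
  · have h0 : γ = 0 := h0.symm
    rw [h0, zero_smul, sub_zero] at hAU hBU
    have h1 := hw A hAU fun e => by rw [hoA]; exact ha _
    have h2 := hw' B hBU fun e => by rw [hoB]; exact ha _
    rw [dotProduct_comm] at h1 h2
    rw [h0] at hneg
    linarith

/-- If no nonzero vector of `U'` vanishes on `T`, then every `e ∉ T` is in the support of a vector
of `U` which vanishes outside `T ∪ {e}`. -/
theorem exists_apply_ne_zero (hU : OrthogonalPair U U') {T : Set E}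
    (hT : ∀ y ∈ U', (∀ e ∈ T, y e = 0) → y = 0) {e : E} (he : e ∉ T) :
    ∃ u ∈ U, u e ≠ 0 ∧ Function.support u ⊆ insert e T := by
  classical
  by_contra hcon
  push Not at hcon
  let L : ((insert e T)ᶜ : Set E) → U →ₗ[ℝ] ℝ := fun f => LinearMap.proj f.1 ∘ₗ U.subtype
  let K : U →ₗ[ℝ] ℝ := LinearMap.proj e ∘ₗ U.subtype
  -- Otherwise, on `U`, the coordinate `e` is a combination of the coordinates outside `T ∪ {e}`.
  -- This relation is a vector of `U'` that vanishes on `T` but is `1` at `e`.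
  have hK : K ∈ Submodule.span ℝ (Set.range L) := by
    refine mem_span_of_iInf_ker_le_ker fun u hu => ?_
    rw [Submodule.mem_iInf] at hu
    by_contra hne
    refine hcon u u.2 hne fun f hf => ?_
    by_contra hfe
    exact hf (hu ⟨f, hfe⟩)
  obtain ⟨c, hc⟩ := (Submodule.mem_span_range_iff_exists_fun ℝ).1 hK
  let y : E → ℝ := Pi.single e 1 - ∑ f, c f • Pi.single f.1 1
  have hy : y ∈ U' := hU.mem_right y fun u hu => by
    have := congrArg (fun l => l (⟨u, hu⟩ : U)) hc
    simp only [L, K, LinearMap.sum_apply, LinearMap.smul_apply, LinearMap.comp_apply,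
      Submodule.subtype_apply, LinearMap.proj_apply, smul_eq_mul] at this
    simp only [y, dotProduct_sub, dotProduct_single_one, dotProduct_sum, dotProduct_smul,
      smul_eq_mul, this, sub_self]
  have hyT : ∀ f, f ∈ insert e T → y f = (Pi.single e 1 : E → ℝ) f := fun f hf => by
    simp only [y, Pi.sub_apply, Finset.sum_apply, Pi.smul_apply, smul_eq_mul, sub_eq_self]
    refine Finset.sum_eq_zero fun i _ => ?_
    rw [Pi.single_eq_of_ne (ne_of_mem_of_not_mem hf i.2), mul_zero]
  have h0 := hT y hy fun f hf => by
    rw [hyT f (Set.mem_insert_of_mem _ hf), Pi.single_eq_of_ne (ne_of_mem_of_not_mem hf he)]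
  have := hyT e (Set.mem_insert _ _)
  simp [h0] at this

end OrthogonalPair

end LinearAlgebra

/-! ### Signed circuits of a subspace, and existence of a compatible basis -/

section Circuits

open Matrix RefGraph

/-- An integral vector, viewed in `ℝ^E`. -/
def realVec {E : Type*} (c : E → ℤ) : E → ℝ := fun e => (c e : ℝ)

@[simp]
theorem realVec_apply {E : Type*} (c : E → ℤ) (e : E) : realVec c e = (c e : ℝ) := rfl

theorem realVec_add {E : Type*} (c d : E → ℤ) : realVec (c + d) = realVec c + realVec d := by
  ext e; simp

theorem realVec_sub {E : Type*} (c d : E → ℤ) : realVec (c - d) = realVec c - realVec d := by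
  ext e; simp

theorem realVec_neg {E : Type*} (c : E → ℤ) : realVec (-c) = -realVec c := by
  ext e; simp

theorem realVec_zero {E : Type*} : realVec (0 : E → ℤ) = 0 := by
  ext e; simp

theorem realVec_eq_zero {E : Type*} {c : E → ℤ} (h : realVec c = 0) : c = 0 := by
  ext e
  have := congrFun h e
  simpa using this

theorem units_mul_self_real (s : ℤˣ) : ((s : ℤ) : ℝ) * ((s : ℤ) : ℝ) = 1 := by
  rcases Int.units_eq_one_or s with h | h <;> simp [h]

theorem eq_units_of_mul_pos {x : ℤ} {s : ℤˣ} {r : ℝ} (hx : x = 0 ∨ x = 1 ∨ x = -1)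
    (h : 0 < (x : ℝ) * r) (hs : 0 ≤ ((s : ℤ) : ℝ) * r) : x = s := by
  rcases hx with rfl | rfl | rfl <;> rcases Int.units_eq_one_or s with rfl | rfl <;>
    simp at h hs ⊢ <;> linarith

variable {E : Type*}

namespace RefGraph

theorem IsIn.eq_zero_or {z : E → ℤ} {O : EdgeOrientation E} (h : IsIn z O) (e : E) :
    z e = 0 ∨ z e = O e :=
  or_iff_not_imp_left.2 (h e)

theorem IsIn.ext_support {z y : E → ℤ} {O : EdgeOrientation E} (hz : IsIn z O) (hy : IsIn y O)
    (h : Function.support z = Function.support y) : z = y := by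
  ext e
  by_cases he : z e = 0
  · have : e ∉ Function.support y := by rw [← h]; simpa using he
    rw [he, Function.notMem_support.1 this]
  · have : e ∈ Function.support y := by rw [← h]; exact he
    rw [hz e he, hy e this]

theorem finite_setOf_isIn [Finite E] (O : EdgeOrientation E) : {z : E → ℤ | IsIn z O}.Finite :=
  Set.Finite.of_injOn (f := Function.support) (t := Set.univ) (fun _ _ => Set.mem_univ _)
    (fun _ hz _ hy h => IsIn.ext_support hz hy h) Set.finite_univ

theorem reverseOn_of_mem {A : Set E} {O : EdgeOrientation E} {e : E} (h : e ∈ A) :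
    reverseOn A O e = -O e := if_pos h

theorem reverseOn_of_notMem {A : Set E} {O : EdgeOrientation E} {e : E} (h : e ∉ A) :
    reverseOn A O e = O e := if_neg h

theorem reverseOn_reverseOn (A : Set E) (O : EdgeOrientation E) :
    reverseOn A (reverseOn A O) = O := by
  ext e
  by_cases h : e ∈ A
  · rw [reverseOn_of_mem h, reverseOn_of_mem h, neg_neg]
  · rw [reverseOn_of_notMem h, reverseOn_of_notMem h]

theorem IsIn.neg_reverseOn {z : E → ℤ} {O : EdgeOrientation E} (hz : IsIn z O) {A : Set E}
    (hA : Function.support z ⊆ A) : IsIn (-z) (reverseOn A O) := by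
  intro e he
  have he : z e ≠ 0 := by simpa using he
  rw [reverseOn_of_mem (hA he), Pi.neg_apply, hz e he, Units.val_neg]

end RefGraph

variable {U U' : Submodule ℝ (E → ℝ)}

theorem OrthogonalPair.disjoint_support [Fintype E] (hU : OrthogonalPair U U') {z y : E → ℤ}
    (hz : realVec z ∈ U) (hy : realVec y ∈ U') (h : ∀ e, 0 ≤ z e * y e) :
    Disjoint (Function.support z) (Function.support y) := by
  have h0 : ∑ e, (z e * y e) = 0 := by
    have := hU.dotProduct_eq_zero _ hz _ hy
    simp only [dotProduct, realVec_apply] at this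
    exact_mod_cast this
  have h1 := (Finset.sum_eq_zero_iff_of_nonneg fun e _ => h e).1 h0
  rw [Set.disjoint_left]
  intro e hez hey
  exact mul_ne_zero hez hey (h1 e (Finset.mem_univ e))

theorem OrthogonalPair.disjoint_support_of_isIn [Fintype E] (hU : OrthogonalPair U U') {z y : E → ℤ}
    {O : EdgeOrientation E} (hz : realVec z ∈ U) (hy : realVec y ∈ U')
    (hzO : IsIn z O) (hyO : IsIn y O) :
    Disjoint (Function.support z) (Function.support y) :=
  hU.disjoint_support hz hy fun e => by
    rcases hzO.eq_zero_or e with h | h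
    · simp [h]
    · rcases hyO.eq_zero_or e with h' | h'
      · simp [h']
      · rw [h, h']; exact mul_self_nonneg _

/-- `D` is a set of signed circuits of the subspace `U`: vectors of `U` with entries `0, 1, -1`
and incomparable supports such that every nonzero vector of `U` has a conformal one. -/
structure IsCircuitSet (U : Submodule ℝ (E → ℝ)) (D : Set (E → ℤ)) : Prop where
  realVec_mem : ∀ c ∈ D, realVec c ∈ U
  apply_eq : ∀ c ∈ D, ∀ e, c e = 0 ∨ c e = 1 ∨ c e = -1
  ne_zero : ∀ c ∈ D, c ≠ 0
  neg_mem : ∀ c ∈ D, -c ∈ D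
  exists_conformal : ∀ u ∈ U, u ≠ 0 → ∃ c ∈ D, ∀ e, c e ≠ 0 → 0 < (c e : ℝ) * u e
  support_eq : ∀ c ∈ D, ∀ d ∈ D, Function.support c ⊆ Function.support d →
    Function.support c = Function.support d

/-- Every edge `e ∉ T` is directed by `O` as in the `w`-positive circuit contained in
`T ∪ {e}`. -/
def IsFundamental [Fintype E] (D : Set (E → ℤ)) (w : E → ℝ) (T : Set E) (O : EdgeOrientation E) : Prop :=
  ∀ e, e ∉ T → ∃ c ∈ D, Function.support c ⊆ insert e T ∧ c e = O e ∧ 0 < w ⬝ᵥ realVec c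

namespace IsCircuitSet

variable {D D' : Set (E → ℤ)}

theorem exists_support_subset (hD : IsCircuitSet U D) {u : E → ℝ} (hu : u ∈ U) (h0 : u ≠ 0) :
    ∃ c ∈ D, Function.support c ⊆ Function.support u := by
  obtain ⟨c, hc, h⟩ := hD.exists_conformal u hu h0
  refine ⟨c, hc, fun e he hue => ?_⟩
  have := h e he
  rw [hue, mul_zero] at this
  exact lt_irrefl _ this

theorem isIn_of_conformal (hD : IsCircuitSet U D) {c : E → ℤ} (hc : c ∈ D)
    {O : EdgeOrientation E} {u : E → ℝ} (hu : ∀ e, 0 ≤ ((O e : ℤ) : ℝ) * u e)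
    (h : ∀ e, c e ≠ 0 → 0 < (c e : ℝ) * u e) : IsIn c O :=
  fun e he => eq_units_of_mul_pos (hD.apply_eq c hc e) (h e he) (hu e)

/-- If `c` and `d` agree at some point of their common support but not everywhere, then `c - d` is a
nonzero vector of strictly smaller support, and a circuit inside it violates incomparability. -/
theorem eq_or_eq_neg (hD : IsCircuitSet U D) {c d : E → ℤ} (hc : c ∈ D) (hd : d ∈ D)
    (h : Function.support c = Function.support d) : c = d ∨ c = -d := by
  by_contra hcon
  push Not at hcon
  have h1 : realVec (c - d) ≠ 0 := fun h0 => hcon.1 (sub_eq_zero.1 (realVec_eq_zero h0))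
  have h2 : ∃ e, e ∈ Function.support d ∧ c e = d e := by
    by_contra hne
    push Not at hne
    refine hcon.2 (funext fun e => ?_)
    by_cases he : e ∈ Function.support d
    · have h3 := hne e he
      have h4 : c e ≠ 0 := by rwa [← h] at he
      have h5 : d e ≠ 0 := he
      rw [Pi.neg_apply]
      rcases hD.apply_eq c hc e with h6 | h6 | h6 <;>
        rcases hD.apply_eq d hd e with h7 | h7 | h7 <;> simp_all
    · have h3 : e ∉ Function.support c := by rwa [h]
      rw [Pi.neg_apply, Function.notMem_support.1 he, Function.notMem_support.1 h3, neg_zero]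
  obtain ⟨e, he, hce⟩ := h2
  have hmem : realVec (c - d) ∈ U := by
    rw [realVec_sub]
    exact U.sub_mem (hD.realVec_mem c hc) (hD.realVec_mem d hd)
  obtain ⟨b, hb, hsub⟩ := hD.exists_support_subset hmem h1
  have hsub' : Function.support b ⊆ Function.support d := fun f hf hdf => by
    have hcf : c f = 0 := by
      rw [← Function.notMem_support, h, Function.notMem_support]
      exact hdf
    exact hsub hf (by simp [hcf, hdf])
  have := hD.support_eq b hb d hd hsub'
  rw [← this] at he
  exact hsub he (by simp [hce])

variable [Fintype E]

/-- A linear functional positive on the circuits of the orthant `O` is nonnegative on all vectors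
of the orthant. -/
theorem dotProduct_nonneg (hD : IsCircuitSet U D) {w : E → ℝ} {O : EdgeOrientation E}
    (hO : ∀ c ∈ D, IsIn c O → 0 < w ⬝ᵥ realVec c) (u : E → ℝ) (hu : u ∈ U)
    (hOu : ∀ e, 0 ≤ ((O e : ℤ) : ℝ) * u e) : 0 ≤ w ⬝ᵥ u := by
  induction hn : (Function.support u).ncard using Nat.strong_induction_on generalizing u with
  | _ n ih =>
    by_cases h0 : u = 0
    · simp [h0]
    obtain ⟨c, hc, hcu⟩ := hD.exists_conformal u hu h0
    have hcO := hD.isIn_of_conformal hc hOu hcu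
    -- Subtract the largest multiple of `c` that keeps `u` in the orthant; the minimizing coordinate
    -- `e₀` becomes zero.
    obtain ⟨e₀, he₀, hmin⟩ := Set.exists_min_image (Function.support c)
      (fun e => ((O e : ℤ) : ℝ) * u e) (Set.toFinite _)
      (Function.support_nonempty_iff.2 (hD.ne_zero c hc))
    set r := ((O e₀ : ℤ) : ℝ) * u e₀ with hr
    set u' := u - r • realVec c with hu'
    have hu'e : ∀ e, u' e = u e - r * (c e : ℝ) := fun e => by simp [hu']
    have hOu' : ∀ e, 0 ≤ ((O e : ℤ) : ℝ) * u' e := fun e => by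
      rw [hu'e]
      by_cases he : c e = 0
      · simpa [he] using hOu e
      · rw [hcO e he, mul_sub, mul_left_comm, units_mul_self_real, mul_one, sub_nonneg]
        exact hmin e he
    have hu'0 : u' e₀ = 0 := by
      rw [hu'e, hcO e₀ he₀, hr, mul_right_comm, units_mul_self_real, one_mul, sub_self]
    have hss : Function.support u' ⊂ Function.support u := by
      refine Set.ssubset_iff_of_subset (fun e he hue => ?_) |>.2 ⟨e₀, fun h => ?_, ?_⟩
      · have : c e = 0 := by
          by_contra hce
          have := hcu e hce
          rw [hue, mul_zero] at this
          exact lt_irrefl _ this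
        refine he ?_
        rw [hu'e, this, hue]; simp
      · have := hcu e₀ he₀
        rw [h, mul_zero] at this
        exact lt_irrefl _ this
      · simpa using hu'0
    have h1 := ih _ (hn ▸ Set.ncard_lt_ncard hss) u'
      (U.sub_mem hu (U.smul_mem _ (hD.realVec_mem c hc))) hOu' rfl
    rw [hu', dotProduct_sub, dotProduct_smul, smul_eq_mul] at h1
    have h2 := mul_nonneg (hOu e₀) (hO c hc hcO).le
    linarith

/-- An integral vector of `U` in the orientation `O` is the sum of disjoint circuits. -/
theorem exists_disjoint_circuits (hD : IsCircuitSet U D) {O : EdgeOrientation E} (z : E → ℤ)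
    (hz : realVec z ∈ U) (hzO : IsIn z O) :
    ∃ 𝒞 : Set (E → ℤ), (∀ c ∈ 𝒞, c ∈ D ∧ IsIn c O) ∧ 𝒞.PairwiseDisjoint Function.support ∧
      edgesOf 𝒞 = Function.support z := by
  induction hn : (Function.support z).ncard using Nat.strong_induction_on generalizing z with
  | _ n ih =>
    by_cases h0 : z = 0
    · exact ⟨∅, by simp, by simp, by simp [edgesOf, h0]⟩
    obtain ⟨c, hc, hcz⟩ := hD.exists_conformal _ hz fun h => h0 (realVec_eq_zero h)
    have hcO : IsIn c O := hD.isIn_of_conformal hc (fun e => by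
      rcases hzO.eq_zero_or e with h | h
      · simp [h]
      · rw [realVec_apply, h]; exact mul_self_nonneg _) hcz
    -- Since `z` has entries `0, 1, -1`, subtracting a conformal circuit just erases the support of
    -- that circuit.
    have hsub : ∀ e, c e ≠ 0 → z e = c e := fun e he => by
      rw [hcO e he, hzO e]
      intro h
      have := hcz e he
      rw [realVec_apply, h, Int.cast_zero, mul_zero] at this
      exact lt_irrefl _ this
    have hsupp : Function.support (z - c) = Function.support z \ Function.support c := by
      ext e
      by_cases he : c e = 0
      · simp [he]
      · simp [he, hsub e he]
    have hlt : (Function.support (z - c)).ncard < n := by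
      rw [← hn, hsupp]
      obtain ⟨e, he⟩ := Function.support_nonempty_iff.2 (hD.ne_zero c hc)
      refine Set.ncard_lt_ncard (Set.ssubset_iff_of_subset Set.sdiff_subset |>.2
        ⟨e, ?_, fun h => h.2 he⟩)
      rw [Function.mem_support, hsub e he]
      exact he
    obtain ⟨𝒞, h𝒞, hdisj, hedges⟩ := ih _ hlt (z - c)
      (by rw [realVec_sub]; exact U.sub_mem hz (hD.realVec_mem c hc))
      (fun e he => by
        by_cases hce : c e = 0
        · have : z e ≠ 0 := by simpa [hce] using he
          simpa [hce] using hzO e this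
        · exact absurd (by simp [hsub e hce]) he) rfl
    refine ⟨insert c 𝒞, ?_, ?_, ?_⟩
    · rintro d (rfl | hd)
      · exact ⟨hc, hcO⟩
      · exact h𝒞 d hd
    · refine hdisj.insert fun d hd _ => ?_
      have : Function.support d ⊆ Function.support z \ Function.support c := by
        rw [← hsupp, ← hedges]
        exact Set.subset_biUnion_of_mem (u := Function.support) hd
      exact (Set.disjoint_sdiff_left.mono_left this).symm
    · have : edgesOf (insert c 𝒞) = Function.support c ∪ edgesOf 𝒞 := by
        simp [edgesOf]
      rw [this, hedges, hsupp, Set.union_sdiff_cancel]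
      intro e he
      rw [Function.mem_support, hsub e he]
      exact he

/-- The sum of disjoint circuits in the orientation `O`. -/
theorem exists_support_eq_edgesOf (hD : IsCircuitSet U D) {O : EdgeOrientation E}
    {𝒞 : Set (E → ℤ)} (h𝒞 : ∀ c ∈ 𝒞, c ∈ D ∧ IsIn c O)
    (hdisj : 𝒞.PairwiseDisjoint Function.support) :
    ∃ z : E → ℤ, realVec z ∈ U ∧ IsIn z O ∧ Function.support z = edgesOf 𝒞 := by
  have hfin : 𝒞.Finite := (finite_setOf_isIn O).subset fun c hc => (h𝒞 c hc).2
  induction 𝒞, hfin using Set.Finite.induction_on with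
  | empty => exact ⟨0, by rw [realVec_zero]; exact U.zero_mem, fun e he => absurd rfl he,
      by simp [edgesOf]⟩
  | @insert c 𝒞 hc _ ih =>
    obtain ⟨z, hz, hzO, hsupp⟩ := ih (fun d hd => h𝒞 d (Set.mem_insert_of_mem _ hd))
      (hdisj.subset (Set.subset_insert _ _))
    obtain ⟨hcD, hcO⟩ := h𝒞 c (Set.mem_insert _ _)
    have hcz : ∀ e, c e ≠ 0 → z e = 0 := fun e he => by
      rw [← Function.notMem_support, hsupp]
      intro h
      simp only [edgesOf, Set.mem_iUnion] at h
      obtain ⟨d, hd, hde⟩ := h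
      exact Set.disjoint_left.1 (hdisj (Set.mem_insert _ _) (Set.mem_insert_of_mem _ hd)
        (fun h => hc (h ▸ hd))) he hde
    refine ⟨z + c, ?_, fun e he => ?_, ?_⟩
    · rw [realVec_add]
      exact U.add_mem hz (hD.realVec_mem c hcD)
    · by_cases hce : c e = 0
      · have : z e ≠ 0 := by simpa [hce] using he
        simpa [hce] using hzO e this
      · simpa [hcz e hce] using hcO e hce
    · have : edgesOf (insert c 𝒞) = Function.support c ∪ edgesOf 𝒞 := by
        simp [edgesOf]
      rw [this, ← hsupp]
      ext e
      by_cases hce : c e = 0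
      · simp [hce]
      · simp [hce, hcz e hce]

theorem exists_minimal (U : Submodule ℝ (E → ℝ)) (w : E → ℝ) (O : EdgeOrientation E) :
    ∃ z : E → ℤ, realVec z ∈ U ∧ IsIn z O ∧
      ∀ z', realVec z' ∈ U → IsIn z' O → w ⬝ᵥ realVec z ≤ w ⬝ᵥ realVec z' := by
  obtain ⟨z, hz, hmin⟩ := Set.exists_min_image {z : E → ℤ | realVec z ∈ U ∧ IsIn z O}
    (fun z => w ⬝ᵥ realVec z) ((finite_setOf_isIn O).subset fun z hz => hz.2)
    ⟨0, by rw [realVec_zero]; exact U.zero_mem, fun e he => absurd rfl he⟩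
  exact ⟨z, hz.1, hz.2, fun z' h1 h2 => hmin z' ⟨h1, h2⟩⟩

/-- By orthogonality, a circuit `c` in the reversed orientation avoids the support of `y`. So `c`
either cancels or extends `z` at each edge of its support, and `z + c` is again a competitor in `O`.
Minimality gives `0 ≤ w ⬝ᵥ realVec c`, and equality is excluded by `hw`. -/
theorem dotProduct_pos_of_minimal (hD : IsCircuitSet U D) (hU : OrthogonalPair U U')
    {w : E → ℝ} (hw : ∀ c ∈ D, w ⬝ᵥ realVec c ≠ 0) {O : EdgeOrientation E} {z y : E → ℤ}
    (hz : realVec z ∈ U) (hzO : IsIn z O)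
    (hmin : ∀ z', realVec z' ∈ U → IsIn z' O → w ⬝ᵥ realVec z ≤ w ⬝ᵥ realVec z')
    (hy : realVec y ∈ U') (hyO : IsIn y O) (c : E → ℤ) (hc : c ∈ D)
    (hcO : IsIn c (reverseOn (Function.support z ∪ Function.support y) O)) :
    0 < w ⬝ᵥ realVec c := by
  refine (hw c hc).symm.lt_of_le ?_
  have hcy := hU.disjoint_support_of_isIn (hD.realVec_mem c hc)
    (by rw [realVec_neg]; exact U'.neg_mem hy) hcO
    (hyO.neg_reverseOn Set.subset_union_right)
  rw [Function.support_neg, Set.disjoint_left] at hcy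
  have h1 := hmin (z + c) (by rw [realVec_add]; exact U.add_mem hz (hD.realVec_mem c hc))
    (fun e he => by
      by_cases hce : c e = 0
      · have : z e ≠ 0 := by simpa [hce] using he
        simpa [hce] using hzO e this
      · have h2 := hcO e hce
        by_cases hze : z e = 0
        · rw [reverseOn_of_notMem (by
            rintro (h | h)
            · exact h hze
            · exact hcy hce h)] at h2
          simpa [hze] using h2
        · rw [reverseOn_of_mem (Set.mem_union_left _ hze)] at h2
          refine absurd ?_ he
          simp [h2, hzO e hze])
  rw [realVec_add, dotProduct_add] at h1
  linarith

/-- If `O` is fundamental for `T`, then `w` is represented modulo `Uᗮ` by a vector of the orthant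
`O` supported off `T`. -/
theorem exists_representative (hD : IsCircuitSet U D) {w : E → ℝ} {T : Set E}
    {O : EdgeOrientation E} (hT : ∀ u ∈ U, Function.support u ⊆ T → u = 0)
    (h : IsFundamental D w T O) :
    ∃ p : E → ℝ, (∀ u ∈ U, p ⬝ᵥ u = w ⬝ᵥ u) ∧ (∀ e ∈ T, p e = 0) ∧
      ∀ e, e ∉ T → 0 < ((O e : ℤ) : ℝ) * p e := by
  classical
  unfold IsFundamental at h
  choose! c hcD hcT hcO hcw using h
  -- Off `T`, the coordinate at `e` has to be the weight of the fundamental circuit of `e`, up to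
  -- the sign `O e`.
  refine ⟨fun e => if e ∈ T then 0 else ((O e : ℤ) : ℝ) * (w ⬝ᵥ realVec (c e)), fun u hu => ?_,
    fun e he => if_pos he, fun e he => ?_⟩
  -- Expansion of `u` in fundamental circuits: the difference vanishes off `T`, hence is zero.
  · have hsum : u - ∑ e, (if e ∈ T then 0 else (u e * ((O e : ℤ) : ℝ)) • realVec (c e)) = 0 := by
      refine hT _ (U.sub_mem hu (U.sum_mem fun e _ => ?_)) fun f hf => ?_
      · split_ifs with he
        · exact U.zero_mem
        · exact U.smul_mem _ (hD.realVec_mem _ (hcD e he))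
      · by_contra hfT
        refine hf ?_
        rw [Pi.sub_apply, Finset.sum_apply, Finset.sum_eq_single f]
        · rw [if_neg hfT, Pi.smul_apply, realVec_apply, hcO f hfT, smul_eq_mul, mul_assoc,
            units_mul_self_real, mul_one, sub_self]
        · intro e _ hef
          split_ifs with he
          · rfl
          · have : c e f = 0 := by
              by_contra hne
              rcases hcT e he hne with h | h
              · exact hef h.symm
              · exact hfT h
            simp [this]
        · simp
    conv_rhs => rw [sub_eq_zero.1 hsum]
    rw [dotProduct_sum, dotProduct]
    refine Finset.sum_congr rfl fun e _ => ?_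
    split_ifs with he
    · simp
    · rw [dotProduct_smul, smul_eq_mul]; ring
  · simp only [if_neg he]
    rw [← mul_assoc, units_mul_self_real, one_mul]
    exact hcw e he

/-- A circuit `c` inside `T ∪ {e}` meets the support of `p` at most in `e`, so `w ⬝ᵥ realVec c = p e
* c e`: the sign of `c e` for the positive circuit is that of `p e`, which is the direction of `e`
in `O`. -/
theorem isFundamental_of_representative (hD : IsCircuitSet U D) (hU : OrthogonalPair U U')
    {w : E → ℝ} (hw : ∀ c ∈ D, w ⬝ᵥ realVec c ≠ 0) {T : Set E} {O : EdgeOrientation E}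
    (hT' : ∀ y ∈ U', Function.support y ⊆ Tᶜ → y = 0) {p : E → ℝ}
    (hp : ∀ u ∈ U, p ⬝ᵥ u = w ⬝ᵥ u) (hpT : ∀ e ∈ T, p e = 0)
    (hpO : ∀ e, 0 ≤ ((O e : ℤ) : ℝ) * p e) : IsFundamental D w T O := by
  intro e he
  obtain ⟨u, hu, hue, husub⟩ := hU.exists_apply_ne_zero
    (fun y hy h => hT' y hy fun f hf hfT => hf (h f hfT)) he
  have hu0 : u ≠ 0 := fun h => hue (by simp [h])
  have : ∃ c ∈ D, Function.support c ⊆ insert e T ∧ 0 < w ⬝ᵥ realVec c := by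
    obtain ⟨c, hc, hcu⟩ := hD.exists_support_subset hu hu0
    rcases lt_or_gt_of_ne (hw c hc) with h | h
    · refine ⟨-c, hD.neg_mem c hc, ?_, ?_⟩
      · rw [Function.support_neg]; exact hcu.trans husub
      · rw [realVec_neg, dotProduct_neg]; linarith
    · exact ⟨c, hc, hcu.trans husub, h⟩
  obtain ⟨c, hc, hsub, hpos⟩ := this
  refine ⟨c, hc, hsub, ?_, hpos⟩
  have h1 : p ⬝ᵥ realVec c = p e * c e := by
    rw [dotProduct, Finset.sum_eq_single e]
    · rfl
    · intro f _ hfe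
      by_cases hf : f ∈ T
      · rw [hpT f hf, zero_mul]
      · have : c f = 0 := by
          by_contra hne
          rcases hsub hne with h | h
          · exact hfe h
          · exact hf h
        simp [this]
    · simp
  rw [← hp _ (hD.realVec_mem c hc), h1, mul_comm] at hpos
  exact eq_units_of_mul_pos (hD.apply_eq c hc e) hpos (hpO e)

/-- Every orientation whose circuits are `w`-positive and whose cocircuits are `w'`-positive is
fundamental for some basis `T`. -/
theorem exists_isFundamental (hD : IsCircuitSet U D) (hD' : IsCircuitSet U' D')
    (hU : OrthogonalPair U U') {w w' : E → ℝ} (hw : ∀ c ∈ D, w ⬝ᵥ realVec c ≠ 0)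
    (hw' : ∀ c ∈ D', w' ⬝ᵥ realVec c ≠ 0) {O : EdgeOrientation E}
    (hO : ∀ c ∈ D, IsIn c O → 0 < w ⬝ᵥ realVec c)
    (hO' : ∀ c ∈ D', IsIn c O → 0 < w' ⬝ᵥ realVec c) :
    ∃ T : Set E, (∀ u ∈ U, Function.support u ⊆ T → u = 0) ∧
      (∀ y ∈ U', Function.support y ⊆ Tᶜ → y = 0) ∧
      IsFundamental D w T O ∧ IsFundamental D' w' Tᶜ O := by
  obtain ⟨p, q, hp, hq, hpO, hqO, hpq⟩ := hU.exists_complementary w w'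
    (fun e => ((O e : ℤ) : ℝ)) (fun e => units_mul_self_real _)
    (hD.dotProduct_nonneg hO) (hD'.dotProduct_nonneg hO')
  have hp' : ∀ u ∈ U, p ⬝ᵥ u = w ⬝ᵥ u := fun u hu => by
    have := hU.dotProduct_eq_zero u hu _ hp
    rw [dotProduct_comm, sub_dotProduct] at this
    linarith
  have hq' : ∀ u ∈ U', q ⬝ᵥ u = w' ⬝ᵥ u := fun u hu => by
    have := hU.dotProduct_eq_zero _ hq u hu
    rw [sub_dotProduct] at this
    linarith
  have hpT : ∀ e ∈ Function.support q, p e = 0 := fun e he =>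
    (mul_eq_zero.1 (hpq e)).resolve_right he
  have hqT : ∀ e ∈ (Function.support q)ᶜ, q e = 0 := fun e he => Function.notMem_support.1 he
  -- A circuit within the support of `q` misses the support of `p`, so its weight would be `0`.
  have hT : ∀ u ∈ U, Function.support u ⊆ Function.support q → u = 0 := fun u hu hsub => by
    by_contra h0
    obtain ⟨c, hc, hcu⟩ := hD.exists_support_subset hu h0
    refine hw c hc ?_
    rw [← hp' _ (hD.realVec_mem c hc)]
    refine Finset.sum_eq_zero fun e _ => ?_
    by_cases he : c e = 0
    · simp [he]
    · rw [hpT e (hsub (hcu he)), zero_mul]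
  have hT' : ∀ y ∈ U', Function.support y ⊆ (Function.support q)ᶜ → y = 0 := fun u hu hsub => by
    by_contra h0
    obtain ⟨c, hc, hcu⟩ := hD'.exists_support_subset hu h0
    refine hw' c hc ?_
    rw [← hq' _ (hD'.realVec_mem c hc)]
    refine Finset.sum_eq_zero fun e _ => ?_
    by_cases he : c e = 0
    · simp [he]
    · rw [hqT e (hsub (hcu he)), zero_mul]
  exact ⟨Function.support q, hT, hT', hD.isFundamental_of_representative hU hw hT' hp' hpT hpO,
    hD'.isFundamental_of_representative hU.symm hw' (by rwa [compl_compl]) hq' hqT hqO⟩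

end IsCircuitSet

end Circuits

/-! ### Uniqueness: agreeing reversal data coincide -/

section Reversal

open Matrix RefGraph

variable {E : Type*} [Fintype E]

/-- A basis `T` together with an orientation `g` induced on both sides of `T` by representatives
`p` and `q` of the weights `w` and `w'`, and vectors `z`, `y` of `U`, `U'` in `g` to be
reversed. -/
structure ReversalDatum (U U' : Submodule ℝ (E → ℝ)) (w w' : E → ℝ) where
  g : EdgeOrientation E
  T : Set E
  z : E → ℤ
  y : E → ℤ
  p : E → ℝ
  q : E → ℝ
  eq_zero_left : ∀ u ∈ U, Function.support u ⊆ T → u = 0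
  eq_zero_right : ∀ u ∈ U', Function.support u ⊆ Tᶜ → u = 0
  p_dotProduct : ∀ u ∈ U, p ⬝ᵥ u = w ⬝ᵥ u
  q_dotProduct : ∀ u ∈ U', q ⬝ᵥ u = w' ⬝ᵥ u
  p_eq_zero : ∀ e ∈ T, p e = 0
  q_eq_zero : ∀ e ∈ Tᶜ, q e = 0
  p_pos : ∀ e, e ∉ T → 0 < ((g e : ℤ) : ℝ) * p e
  q_pos : ∀ e, e ∉ Tᶜ → 0 < ((g e : ℤ) : ℝ) * q e
  z_mem : realVec z ∈ U
  y_mem : realVec y ∈ U'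
  z_isIn : IsIn z g
  y_isIn : IsIn y g

namespace ReversalDatum

variable {U U' : Submodule ℝ (E → ℝ)} {w w' : E → ℝ}

/-- The datum for the dual matroid. -/
def dual (a : ReversalDatum U U' w w') : ReversalDatum U' U w' w where
  g := a.g
  T := a.Tᶜ
  z := a.y
  y := a.z
  p := a.q
  q := a.p
  eq_zero_left := a.eq_zero_right
  eq_zero_right := by rw [compl_compl]; exact a.eq_zero_left
  p_dotProduct := a.q_dotProduct
  q_dotProduct := a.p_dotProduct
  p_eq_zero := a.q_eq_zero
  q_eq_zero := by rw [compl_compl]; exact a.p_eq_zero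
  p_pos := a.q_pos
  q_pos := by rw [compl_compl]; exact a.p_pos
  z_mem := a.y_mem
  y_mem := a.z_mem
  z_isIn := a.y_isIn
  y_isIn := a.z_isIn

/-- The reversed orientation. -/
noncomputable def orientation (a : ReversalDatum U U' w w') : EdgeOrientation E :=
  reverseOn (Function.support a.z ∪ Function.support a.y) a.g

/-- The set obtained from the basis by adding the support of `z` and deleting that of `y`. -/
def subset (a : ReversalDatum U U' w w') : Set E :=
  (a.T ∪ Function.support a.z) \ Function.support a.y

theorem disjoint (hU : OrthogonalPair U U') (a : ReversalDatum U U' w w') :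
    Disjoint (Function.support a.z) (Function.support a.y) :=
  hU.disjoint_support_of_isIn a.z_mem a.y_mem a.z_isIn a.y_isIn

theorem dual_orientation (a : ReversalDatum U U' w w') : a.dual.orientation = a.orientation := by
  simp only [orientation, dual, Set.union_comm]

theorem dual_subset (hU : OrthogonalPair U U') (a : ReversalDatum U U' w w') :
    a.dual.subset = a.subsetᶜ := by
  have h := Set.disjoint_left.1 (a.disjoint hU)
  ext e
  have := @h e
  simp only [subset, dual, Set.mem_sdiff, Set.mem_union, Set.mem_compl_iff]
  tauto

/-- Wherever the reversed orientations differ, the subsets agree. -/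
def Agree (a b : ReversalDatum U U' w w') : Prop :=
  ∀ e, a.orientation e ≠ b.orientation e → (e ∈ a.subset ↔ e ∈ b.subset)

variable {a b : ReversalDatum U U' w w'}

theorem Agree.symm (h : a.Agree b) : b.Agree a := fun e he => (h e he.symm).symm

theorem Agree.dual (hU : OrthogonalPair U U') (h : a.Agree b) : a.dual.Agree b.dual := by
  intro e he
  rw [dual_orientation, dual_orientation] at he
  rw [dual_subset hU, dual_subset hU]
  exact not_congr (h e he)

theorem orientation_of_z (a : ReversalDatum U U' w w') {e : E} (h : a.z e ≠ 0) :
    a.orientation e = -a.g e := reverseOn_of_mem (Set.mem_union_left _ h)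

theorem orientation_of_y (a : ReversalDatum U U' w w') {e : E} (h : a.y e ≠ 0) :
    a.orientation e = -a.g e := reverseOn_of_mem (Set.mem_union_right _ h)

theorem orientation_of_eq_zero (a : ReversalDatum U U' w w') {e : E} (hz : a.z e = 0)
    (hy : a.y e = 0) : a.orientation e = a.g e :=
  reverseOn_of_notMem fun h => h.elim (fun h => h hz) fun h => h hy

theorem y_eq_zero (hU : OrthogonalPair U U') (a : ReversalDatum U U' w w') {e : E}
    (h : a.z e ≠ 0) : a.y e = 0 :=
  Function.notMem_support.1 (Set.disjoint_left.1 (a.disjoint hU) h)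

theorem mem_subset_of_z (hU : OrthogonalPair U U') (a : ReversalDatum U U' w w') {e : E}
    (h : a.z e ≠ 0) : e ∈ a.subset :=
  ⟨Or.inr h, fun h' => h' (a.y_eq_zero hU h)⟩

theorem mem_subset_iff (a : ReversalDatum U U' w w') {e : E} (hz : a.z e = 0)
    (hy : a.y e = 0) : e ∈ a.subset ↔ e ∈ a.T := by
  simp [subset, hz, hy]

/-- An edge in both supports lies in `a.subset` but not in `b.subset`, so the two reversed
orientations coincide there. Hence `a.z` and `b.y` have equal signs on common edges, and
orthogonality rules such edges out. -/
theorem Agree.z_y_disjoint (hU : OrthogonalPair U U') (h : a.Agree b) :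
    Disjoint (Function.support a.z) (Function.support b.y) := by
  refine hU.disjoint_support a.z_mem b.y_mem fun e => ?_
  by_cases hz : a.z e = 0
  · simp [hz]
  by_cases hy : b.y e = 0
  · simp [hy]
  have h1 : a.orientation e = b.orientation e := by
    by_contra hne
    exact ((h e hne).1 (a.mem_subset_of_z hU hz)).2 hy
  rw [a.orientation_of_z hz, b.orientation_of_y hy, neg_inj] at h1
  rw [a.z_isIn e hz, b.y_isIn e hy, h1]
  exact mul_self_nonneg _

theorem p_nonneg (a : ReversalDatum U U' w w') (e : E) : 0 ≤ ((a.g e : ℤ) : ℝ) * a.p e := by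
  by_cases he : e ∈ a.T
  · rw [a.p_eq_zero e he, mul_zero]
  · exact (a.p_pos e he).le

/-- Where `a.z e ≠ 0`, the entry `a.z e` has the sign of `a.p e` whenever the latter is nonzero, and
subtracting `b.z e` cannot reverse it. If only `b.z e ≠ 0` and `e ∉ a.T`, then `e` lies in
`b.subset` but not in `a.subset`, so the reversed orientations coincide at `e`; only `b` was
reversed there, whence `b.z e` is opposite to `a.g e`. -/
theorem Agree.p_mul_nonneg (hU : OrthogonalPair U U') (h : a.Agree b) (e : E) :
    0 ≤ a.p e * ((a.z e : ℝ) - b.z e) := by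
  have hp := a.p_nonneg e
  by_cases hb : b.z e = 0
  · rcases a.z_isIn.eq_zero_or e with ha | ha
    · simp [ha, hb]
    · rw [ha, hb, Int.cast_zero, sub_zero, mul_comm]; exact hp
  by_cases ha : a.z e = 0
  · by_cases heT : e ∈ a.T
    · rw [a.p_eq_zero e heT, zero_mul]
    have hay : a.y e = 0 :=
      Function.notMem_support.1 (Set.disjoint_left.1 (h.symm.z_y_disjoint hU) hb)
    have h1 : a.orientation e = b.orientation e := by
      by_contra hne
      exact heT ((a.mem_subset_iff ha hay).1 ((h e hne).2 (b.mem_subset_of_z hU hb)))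
    rw [a.orientation_of_eq_zero ha hay, b.orientation_of_z hb] at h1
    rw [h1, Units.val_neg] at hp
    rw [ha, b.z_isIn e hb, Int.cast_zero]
    push_cast at hp
    linarith
  · rw [a.z_isIn e ha, b.z_isIn e hb]
    rcases Int.units_eq_one_or (a.g e) with h1 | h1 <;>
      rcases Int.units_eq_one_or (b.g e) with h2 | h2 <;>
      rw [h1] at hp <;> rw [h1, h2] <;> push_cast at hp ⊢ <;> linarith

/-- Both `a.p` and `b.p` represent `w` on `U`, so they have the same product with `a.z - b.z`. By
`Agree.p_mul_nonneg` all terms must vanish; as `a.p` is nonzero off `a.T`, the difference is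
supported in `a.T`, hence zero. -/
theorem Agree.z_eq (hU : OrthogonalPair U U') (h : a.Agree b) : a.z = b.z := by
  have hmem : realVec (a.z - b.z) ∈ U := by
    rw [realVec_sub]; exact U.sub_mem a.z_mem b.z_mem
  have h0 : ∑ e, (a.p e * ((a.z e : ℝ) - b.z e) + b.p e * ((b.z e : ℝ) - a.z e)) = 0 := by
    have h1 := a.p_dotProduct _ hmem
    rw [← b.p_dotProduct _ hmem] at h1
    simp only [dotProduct, realVec_apply, Pi.sub_apply, Int.cast_sub] at h1
    rw [Finset.sum_add_distrib, h1, ← Finset.sum_add_distrib]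
    exact Finset.sum_eq_zero fun e _ => by ring
  have h1 := (Finset.sum_eq_zero_iff_of_nonneg fun e _ =>
    add_nonneg (h.p_mul_nonneg hU e) (h.symm.p_mul_nonneg hU e)).1 h0
  refine sub_eq_zero.1 (realVec_eq_zero (a.eq_zero_left _ hmem fun e he => ?_))
  by_contra heT
  have h2 := h1 e (Finset.mem_univ e)
  have h3 : a.p e * ((a.z e : ℝ) - b.z e) = 0 :=
    le_antisymm (by linarith [h.symm.p_mul_nonneg hU e]) (h.p_mul_nonneg hU e)
  rcases mul_eq_zero.1 h3 with h4 | h4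
  · have := a.p_pos e heT
    rw [h4, mul_zero] at this
    exact lt_irrefl _ this
  · exact he (by simpa using h4)

theorem Agree.y_eq (hU : OrthogonalPair U U') (h : a.Agree b) : a.y = b.y :=
  (h.dual hU).z_eq hU.symm

/-- The reversed vectors are already known to coincide. On their supports they determine the
direction; elsewhere nothing is reversed, and the agreement hypothesis applies directly to the
trees. -/
theorem Agree.g_eq_of_mem (hU : OrthogonalPair U U') (h : a.Agree b) {e : E}
    (ha : ¬(e ∈ a.T ↔ e ∈ b.T)) : a.g e = b.g e := by
  have hz := congrFun (h.z_eq hU) e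
  have hy := congrFun (h.y_eq hU) e
  by_cases hz0 : a.z e = 0
  · by_cases hy0 : a.y e = 0
    · have h1 : a.orientation e = b.orientation e := by
        by_contra hne
        have := h e hne
        rw [a.mem_subset_iff hz0 hy0, b.mem_subset_iff (hz ▸ hz0) (hy ▸ hy0)] at this
        exact ha this
      rwa [a.orientation_of_eq_zero hz0 hy0,
        b.orientation_of_eq_zero (hz ▸ hz0) (hy ▸ hy0)] at h1
    · have h1 := a.y_isIn e hy0
      rw [hy, b.y_isIn e (hy ▸ hy0)] at h1
      exact Units.ext h1.symm
  · have h1 := a.z_isIn e hz0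
    rw [hz, b.z_isIn e (hz ▸ hz0)] at h1
    exact Units.ext h1.symm

theorem Agree.p_mul_q_pos (hU : OrthogonalPair U U') (h : a.Agree b) {e : E} (ha : e ∉ a.T)
    (hb : e ∈ b.T) : 0 < a.p e * b.q e := by
  have hg := h.g_eq_of_mem hU (e := e) (by tauto)
  have h1 := mul_pos (a.p_pos e ha) (b.q_pos e (not_not.2 hb))
  rw [hg] at h1
  have h2 : ((b.g e : ℤ) : ℝ) * a.p e * (((b.g e : ℤ) : ℝ) * b.q e) =
      (((b.g e : ℤ) : ℝ) * ((b.g e : ℤ) : ℝ)) * (a.p e * b.q e) := by ring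
  rwa [h2, units_mul_self_real, one_mul] at h1

theorem Agree.p_mul_q_nonneg (hU : OrthogonalPair U U') (h : a.Agree b) (e : E) :
    0 ≤ a.p e * b.q e := by
  by_cases ha : e ∈ a.T
  · rw [a.p_eq_zero e ha, zero_mul]
  by_cases hb : e ∈ b.T
  · exact (h.p_mul_q_pos hU ha hb).le
  · rw [b.q_eq_zero e hb, mul_zero]

theorem p_mul_q (a : ReversalDatum U U' w w') (e : E) : a.p e * a.q e = 0 := by
  by_cases ha : e ∈ a.T
  · rw [a.p_eq_zero e ha, zero_mul]
  · rw [a.q_eq_zero e ha, mul_zero]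

theorem p_sub_mem (hU : OrthogonalPair U U') (a b : ReversalDatum U U' w w') :
    a.p - b.p ∈ U' := hU.mem_right _ fun u hu => by
  rw [dotProduct_comm, sub_dotProduct, a.p_dotProduct u hu, b.p_dotProduct u hu, sub_self]

/-- The vectors `a.q - b.q` and `a.p - b.p` lie in `U` and `U'`. Their product is zero, and since
`p` and `q` of the same datum have disjoint supports, only the cross terms `a.p e * b.q e + b.p e *
a.q e` survive. These are nonnegative, and positive on `b.T \ a.T`. -/
theorem Agree.T_subset (hU : OrthogonalPair U U') (h : a.Agree b) : b.T ⊆ a.T := by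
  have h0 := hU.dotProduct_eq_zero _ (p_sub_mem hU.symm a.dual b.dual) _ (p_sub_mem hU a b)
  have h1 : ∑ e, (a.p e * b.q e + b.p e * a.q e) = 0 := by
    rw [← neg_zero, ← h0, dotProduct, ← Finset.sum_neg_distrib]
    refine Finset.sum_congr rfl fun e _ => ?_
    have h1 := a.p_mul_q e
    have h2 := b.p_mul_q e
    change _ = -((a.q e - b.q e) * (a.p e - b.p e))
    linear_combination h1 + h2
  have h2 := (Finset.sum_eq_zero_iff_of_nonneg fun e _ =>
    add_nonneg (h.p_mul_q_nonneg hU e) (h.symm.p_mul_q_nonneg hU e)).1 h1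
  intro e heb
  by_contra hea
  linarith [h2 e (Finset.mem_univ e), h.p_mul_q_pos hU hea heb, h.symm.p_mul_q_nonneg hU e]

theorem Agree.T_eq (hU : OrthogonalPair U U') (h : a.Agree b) : a.T = b.T :=
  (h.symm.T_subset hU).antisymm (h.T_subset hU)

theorem p_eq (hU : OrthogonalPair U U') (h : a.T = b.T) : a.p = b.p := by
  refine sub_eq_zero.1 (a.eq_zero_right _ (p_sub_mem hU a b) fun e he heT => he ?_)
  rw [Pi.sub_apply, a.p_eq_zero e heT, b.p_eq_zero e (h ▸ heT), sub_zero]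

/-- Off the tree the direction is the sign of `p`, and `p` is determined by the tree. -/
theorem g_eq_of_notMem (hU : OrthogonalPair U U') (h : a.T = b.T) {e : E} (he : e ∉ a.T) :
    a.g e = b.g e := by
  have h1 := a.p_pos e he
  have h2 := b.p_pos e (h ▸ he)
  rw [← p_eq hU h] at h2
  rcases Int.units_eq_one_or (a.g e) with h3 | h3 <;>
    rcases Int.units_eq_one_or (b.g e) with h4 | h4 <;>
    rw [h3] at h1 <;> rw [h4] at h2 <;> rw [h3, h4] <;> push_cast at h1 h2 <;> linarith

theorem Agree.g_eq (hU : OrthogonalPair U U') (h : a.Agree b) : a.g = b.g := by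
  have hT := h.T_eq hU
  ext e : 1
  by_cases he : e ∈ a.T
  · exact g_eq_of_notMem (a := a.dual) (b := b.dual) hU.symm (congrArg (·ᶜ) hT) (not_not.2 he)
  · exact g_eq_of_notMem hU hT he

theorem Agree.orientation_eq (hU : OrthogonalPair U U') (h : a.Agree b) :
    a.orientation = b.orientation := by
  rw [orientation, orientation, h.z_eq hU, h.y_eq hU, h.g_eq hU]

theorem Agree.subset_eq (hU : OrthogonalPair U U') (h : a.Agree b) : a.subset = b.subset := by
  rw [subset, subset, h.z_eq hU, h.y_eq hU, h.T_eq hU]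

end ReversalDatum

end Reversal

/-! ### Cycle space and cut space of a graph, and their signed circuits -/

section GraphSpaces

open Matrix

namespace RefGraph

variable {V E : Type*} (G : RefGraph V E)

/-- The coboundary of a function on the vertices. -/
def coboundary : (V → ℝ) →ₗ[ℝ] (E → ℝ) where
  toFun f e := f (G.head e) - f (G.tail e)
  map_add' f g := by ext e; simp; ring
  map_smul' c f := by ext e; simp; ring

@[simp]
theorem coboundary_apply (f : V → ℝ) (e : E) :
    G.coboundary f e = f (G.head e) - f (G.tail e) := rfl

/-- The space of real cuts. -/
def cutSpace : Submodule ℝ (E → ℝ) := LinearMap.range G.coboundary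

theorem sign_mul_coboundary (f : V → ℝ) (e : E) (s : ℤˣ) :
    ((s : ℤ) : ℝ) * G.coboundary f e = f (G.arcHead e s) - f (G.arcTail e s) := by
  rcases Int.units_eq_one_or s with rfl | rfl
  · simp [arcHead, arcTail]
  · have : (-1 : ℤˣ) ≠ 1 := by decide
    simp [arcHead, arcTail, this]

theorem arcTail_neg (e : E) (s : ℤˣ) : G.arcTail e (-s) = G.arcHead e s := by
  rcases Int.units_eq_one_or s with rfl | rfl
  · have : (-1 : ℤˣ) ≠ 1 := by decide
    simp [arcHead, arcTail, this]
  · have : (-1 : ℤˣ) ≠ 1 := by decide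
    simp [arcHead, arcTail, this]

theorem arcHead_neg (e : E) (s : ℤˣ) : G.arcHead e (-s) = G.arcTail e s := by
  rw [← arcTail_neg, neg_neg]

theorem joins_arc (e : E) (s : ℤˣ) : G.Joins e (G.arcTail e s) (G.arcHead e s) := by
  by_cases h : s = 1
  · exact Or.inl ⟨by simp [arcTail, h], by simp [arcHead, h]⟩
  · exact Or.inr ⟨by simp [arcHead, h], by simp [arcTail, h]⟩

/-- The cut of `W`, directed from `W` to its complement. -/
noncomputable def directedCut (W : Set V) (e : E) : ℤ :=
  W.indicator 1 (G.tail e) - W.indicator 1 (G.head e)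

theorem directedCut_eq_one_iff {W : Set V} {e : E} :
    G.directedCut W e = 1 ↔ G.tail e ∈ W ∧ G.head e ∉ W := by
  by_cases h1 : G.tail e ∈ W <;> by_cases h2 : G.head e ∈ W <;> simp [directedCut, h1, h2]

theorem directedCut_eq_neg_one_iff {W : Set V} {e : E} :
    G.directedCut W e = -1 ↔ G.tail e ∉ W ∧ G.head e ∈ W := by
  by_cases h1 : G.tail e ∈ W <;> by_cases h2 : G.head e ∈ W <;> simp [directedCut, h1, h2]

theorem directedCut_eq (W : Set V) (e : E) :
    G.directedCut W e = 0 ∨ G.directedCut W e = 1 ∨ G.directedCut W e = -1 := by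
  by_cases h1 : G.tail e ∈ W <;> by_cases h2 : G.head e ∈ W <;> simp [directedCut, h1, h2]

theorem support_directedCut (W : Set V) : Function.support (G.directedCut W) = G.cut W := by
  ext e
  by_cases h1 : G.tail e ∈ W <;> by_cases h2 : G.head e ∈ W <;>
    simp [directedCut, cut, h1, h2]

theorem directedCut_compl (W : Set V) : G.directedCut Wᶜ = -G.directedCut W := by
  ext e
  by_cases h1 : G.tail e ∈ W <;> by_cases h2 : G.head e ∈ W <;> simp [directedCut, h1, h2]

theorem cut_compl (W : Set V) : G.cut Wᶜ = G.cut W := by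
  rw [← support_directedCut, directedCut_compl, Function.support_neg, support_directedCut]

theorem realVec_directedCut_mem (W : Set V) : realVec (G.directedCut W) ∈ G.cutSpace := by
  refine ⟨-W.indicator 1, funext fun e => ?_⟩
  by_cases h1 : G.tail e ∈ W <;> by_cases h2 : G.head e ∈ W <;> simp [directedCut, h1, h2]

theorem isDirectedCocycle_iff {c : E → ℤ} :
    G.IsDirectedCocycle c ↔ ∃ W : Set V, G.IsCocycle (G.cut W) ∧ c = G.directedCut W := by
  refine exists_congr fun W => and_congr_right fun _ => ?_
  rw [funext_iff]
  refine forall_congr' fun e => ?_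
  by_cases h1 : G.tail e ∈ W <;> by_cases h2 : G.head e ∈ W <;> simp [directedCut, h1, h2]

theorem IsDirectedCocycle.isCocycle {c : E → ℤ} (h : G.IsDirectedCocycle c) :
    G.IsCocycle (Function.support c) := by
  obtain ⟨W, hW, rfl⟩ := G.isDirectedCocycle_iff.1 h
  rwa [support_directedCut]

/-- For a potential `f`, a strict sublevel set works: every edge of its cut goes upwards when
directed out of the set. The level is the higher end of an edge where `u` is nonzero, so the cut is
nonempty. -/
theorem exists_conformal_directedCut {u : E → ℝ} (hu : u ∈ G.cutSpace) (h0 : u ≠ 0) :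
    ∃ W : Set V, (G.cut W).Nonempty ∧
      ∀ e, G.directedCut W e ≠ 0 → 0 < (G.directedCut W e : ℝ) * u e := by
  obtain ⟨f, rfl⟩ := hu
  obtain ⟨e₀, he₀⟩ := Function.ne_iff.1 h0
  simp only [coboundary_apply, Pi.zero_apply] at he₀
  refine ⟨{v | f v < max (f (G.head e₀)) (f (G.tail e₀))}, ⟨e₀, ?_⟩, fun e he => ?_⟩
  · rcases lt_or_gt_of_ne (sub_ne_zero.1 he₀) with h | h
    · exact Or.inr ⟨by simp [h.le], by simp [h]⟩
    · exact Or.inl ⟨by simp [h], by simp [h.le]⟩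
  · rcases (G.directedCut_eq _ e).resolve_left he with h | h
    · rw [h]
      obtain ⟨h1, h2⟩ := G.directedCut_eq_one_iff.1 h
      rw [Set.mem_ofPred_eq] at h1 h2
      rw [coboundary_apply]
      push_cast
      linarith
    · rw [h]
      obtain ⟨h1, h2⟩ := G.directedCut_eq_neg_one_iff.1 h
      rw [Set.mem_ofPred_eq] at h1 h2
      rw [coboundary_apply]
      push_cast
      linarith

/-- A conformal cut `W` with fewest edges is a cocycle. Given a nonempty cut properly inside it,
direct that cut as `X` to agree with `W` at one edge `e₁`. A cut conformal to the difference of `W`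
and `X` is also conformal to `W`, but it misses `e₁` and so has fewer edges. -/
theorem exists_conformal_directedCocycle [Finite E] {u : E → ℝ} (hu : u ∈ G.cutSpace)
    (h0 : u ≠ 0) :
    ∃ c, G.IsDirectedCocycle c ∧ ∀ e, c e ≠ 0 → 0 < (c e : ℝ) * u e := by
  have hne : {n | ∃ W : Set V, (G.cut W).Nonempty ∧ (∀ e, G.directedCut W e ≠ 0 →
      0 < (G.directedCut W e : ℝ) * u e) ∧ (G.cut W).ncard = n}.Nonempty := by
    obtain ⟨W, h1, h2⟩ := G.exists_conformal_directedCut hu h0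
    exact ⟨_, W, h1, h2, rfl⟩
  obtain ⟨W, hW, hWu, hn⟩ := Nat.sInf_mem hne
  refine ⟨G.directedCut W, G.isDirectedCocycle_iff.2 ⟨W, ⟨⟨hW, W, rfl⟩, ?_⟩, rfl⟩, hWu⟩
  rintro _ ⟨⟨e₁, he₁⟩, W', rfl⟩ hsub e₀ he₀
  by_contra he₀'
  have hsub : G.cut W' ⊆ G.cut W := hsub
  have key : ∃ X : Set V, G.cut X = G.cut W' ∧ G.directedCut X e₁ = G.directedCut W e₁ := by
    have h1 : G.directedCut W e₁ ≠ 0 := by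
      rw [← Function.mem_support, support_directedCut]; exact hsub he₁
    have h2 : G.directedCut W' e₁ ≠ 0 := by
      rwa [← Function.mem_support, support_directedCut]
    by_cases h3 : G.directedCut W' e₁ = G.directedCut W e₁
    · exact ⟨W', rfl, h3⟩
    · refine ⟨W'ᶜ, G.cut_compl W', ?_⟩
      rw [directedCut_compl, Pi.neg_apply]
      have h4 := G.directedCut_eq W e₁
      have h5 := G.directedCut_eq W' e₁
      omega
  obtain ⟨X, hX, hXe⟩ := key
  have hmem : realVec (G.directedCut W - G.directedCut X) ∈ G.cutSpace := by
    rw [realVec_sub]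
    exact G.cutSpace.sub_mem (G.realVec_directedCut_mem W) (G.realVec_directedCut_mem X)
  have hXW : ∀ e, G.directedCut W e = 0 → G.directedCut X e = 0 := fun e he => by
    rw [← Function.notMem_support, support_directedCut] at he ⊢
    rw [hX]
    exact fun h => he (hsub h)
  have hne0 : realVec (G.directedCut W - G.directedCut X) ≠ 0 := by
    intro h
    have h1 := congrFun (realVec_eq_zero h) e₀
    have h2 : G.directedCut X e₀ = 0 := by
      rw [← Function.notMem_support, support_directedCut, hX]; exact he₀'
    rw [Pi.sub_apply, h2, sub_zero, Pi.zero_apply, ← Function.notMem_support,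
      support_directedCut] at h1
    exact h1 he₀
  obtain ⟨Y, hY, hYu⟩ := G.exists_conformal_directedCut hmem hne0
  have hval : ∀ e, G.directedCut Y e ≠ 0 → G.directedCut Y e = G.directedCut W e ∧
      G.directedCut W e ≠ G.directedCut X e := fun e he => by
    have h1 := hYu e he
    rw [realVec_apply] at h1
    have h1 : 0 < G.directedCut Y e * (G.directedCut W e - G.directedCut X e) := by
      exact_mod_cast h1
    have h2 := hXW e
    rcases G.directedCut_eq W e with h | h | h <;> rcases G.directedCut_eq X e with h' | h' | h' <;>
      rcases G.directedCut_eq Y e with h'' | h'' | h'' <;> simp_all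
  have hYW : G.cut Y ⊆ G.cut W := by
    rw [← support_directedCut, ← support_directedCut]
    intro e he
    rw [Function.mem_support, ← (hval e he).1]
    exact he
  have hlt : (G.cut Y).ncard < (G.cut W).ncard := by
    refine Set.ncard_lt_ncard (Set.ssubset_iff_of_subset hYW |>.2 ⟨e₁, hsub he₁, fun h => ?_⟩)
    rw [← support_directedCut] at h
    exact (hval e₁ h).2 hXe.symm
  rw [hn] at hlt
  refine Nat.notMem_of_lt_sInf hlt ⟨Y, hY, fun e he => ?_, rfl⟩
  rw [(hval e he).1]
  exact hWu e ((hval e he).1 ▸ he)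

theorem isCircuitSet_cocycles [Finite E] :
    IsCircuitSet G.cutSpace {c | G.IsDirectedCocycle c} where
  realVec_mem c hc := by
    obtain ⟨W, -, rfl⟩ := G.isDirectedCocycle_iff.1 hc
    exact G.realVec_directedCut_mem W
  apply_eq c hc e := by
    obtain ⟨W, -, rfl⟩ := G.isDirectedCocycle_iff.1 hc
    exact G.directedCut_eq W e
  ne_zero c hc := Function.support_nonempty_iff.1 hc.isCocycle.prop.1
  neg_mem c hc := by
    obtain ⟨W, hW, rfl⟩ := G.isDirectedCocycle_iff.1 hc
    exact G.isDirectedCocycle_iff.2 ⟨Wᶜ, by rwa [cut_compl], (G.directedCut_compl W).symm⟩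
  exists_conformal u hu h0 := G.exists_conformal_directedCocycle hu h0
  support_eq c hc d hd h := h.antisymm (hd.isCocycle.2 hc.isCocycle.prop h)

theorem IsDirectedCycle.isCycle {c : E → ℤ} (h : G.IsDirectedCycle c) :
    G.IsCycle (Function.support c) := by
  obtain ⟨n, v, ε, s, hv, hε, harc, hc, hc'⟩ := h
  refine ⟨n, v, ε, hv, hε, fun i => ?_, ?_⟩
  · rw [← (harc i).1, ← (harc i).2]
    exact G.joins_arc _ _
  · ext e
    constructor
    · intro he
      by_contra hne
      exact he (hc' e hne)
    · rintro ⟨i, rfl⟩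
      rw [Function.mem_support, hc]
      exact (s i).ne_zero

theorem IsDirectedCycle.apply_eq {c : E → ℤ} (h : G.IsDirectedCycle c) (e : E) :
    c e = 0 ∨ c e = 1 ∨ c e = -1 := by
  obtain ⟨n, v, ε, s, hv, hε, harc, hc, hc'⟩ := h
  by_cases he : e ∈ Set.range ε
  · obtain ⟨i, rfl⟩ := he
    rw [hc]
    rcases Int.units_eq_one_or (s i) with h | h <;> simp [h]
  · exact Or.inl (hc' e he)

theorem IsDirectedCycle.ne_zero {c : E → ℤ} (h : G.IsDirectedCycle c) : c ≠ 0 := by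
  obtain ⟨n, v, ε, s, hv, hε, harc, hc, hc'⟩ := h
  intro h0
  have := hc 0
  rw [h0] at this
  exact (s 0).ne_zero this.symm

theorem IsDirectedCycle.neg {c : E → ℤ} (h : G.IsDirectedCycle c) : G.IsDirectedCycle (-c) := by
  obtain ⟨n, v, ε, s, hv, hε, harc, hc, hc'⟩ := h
  -- The cycle is traversed backwards: from `v (-i)` to `v (-(i + 1))` along the reverse of `ε (-(i
  -- + 1))`.
  have hidx : ∀ i : Fin (n + 1), -(i + 1) + 1 = -i := fun i => by
    rw [neg_add, neg_add_cancel_right]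
  refine ⟨n, fun i => v (-i), fun i => ε (-(i + 1)), fun i => -s (-(i + 1)),
    hv.comp neg_injective, hε.comp (neg_injective.comp (add_left_injective 1)), fun i => ?_,
    fun i => ?_, fun e he => ?_⟩
  · rw [arcTail_neg, arcHead_neg, (harc _).1, (harc _).2, hidx]
    exact ⟨rfl, rfl⟩
  · rw [Pi.neg_apply, hc, Units.val_neg]
  · rw [Pi.neg_apply, hc', neg_zero]
    rintro ⟨i, rfl⟩
    refine he ⟨-i - 1, ?_⟩
    simp

/-- A nonempty set of arcs in which every arc can be continued contains a directed cycle. -/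
theorem exists_directedCycle [Finite V] (s : E → ℤˣ) (A : Set E) (hA : A.Nonempty)
    (h : ∀ e ∈ A, ∃ e' ∈ A, G.arcTail e' (s e') = G.arcHead e (s e)) :
    ∃ c, G.IsDirectedCycle c ∧ ∀ e, c e ≠ 0 → e ∈ A ∧ c e = s e := by
  classical
  obtain ⟨e₀, he₀⟩ := hA
  have hsucc : ∀ v : V, ∃ e : E, (∃ e ∈ A, G.arcTail e (s e) = v) →
      e ∈ A ∧ G.arcTail e (s e) = v := fun v => by
    by_cases hv : ∃ e ∈ A, G.arcTail e (s e) = v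
    · obtain ⟨e, he⟩ := hv
      exact ⟨e, fun _ => he⟩
    · exact ⟨e₀, fun h => absurd h hv⟩
  -- Here `ε v` is an arc of `A` leaving `v`, if there is one; `f` follows it. On a finite vertex
  -- set some orbit is periodic, and one minimal period visits distinct vertices.
  choose ε hε using hsucc
  set f : V → V := fun v => G.arcHead (ε v) (s (ε v)) with hf
  let X : Set V := {v | ∃ e ∈ A, G.arcTail e (s e) = v}
  have hfX : Set.MapsTo f X X := fun v hv => h (ε v) (hε v hv).1
  have hx₀ : G.arcTail e₀ (s e₀) ∈ X := ⟨e₀, he₀, rfl⟩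
  obtain ⟨m, n, hmn, heq⟩ := Finite.exists_ne_map_eq_of_infinite
    (fun n : ℕ => f^[n] (G.arcTail e₀ (s e₀)))
  have hper : ∃ x ∈ X, x ∈ Function.periodicPts f := by
    wlog hlt : m < n generalizing m n
    · exact this n m hmn.symm heq.symm (lt_of_le_of_ne (not_lt.1 hlt) hmn.symm)
    refine ⟨f^[m] (G.arcTail e₀ (s e₀)), hfX.iterate m hx₀, n - m, Nat.sub_pos_of_lt hlt, ?_⟩
    rw [Function.IsPeriodicPt, Function.IsFixedPt, ← Function.iterate_add_apply,
      Nat.sub_add_cancel hlt.le]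
    exact heq.symm
  obtain ⟨x, hxX, hx⟩ := hper
  obtain ⟨k, hk⟩ := Nat.exists_eq_succ_of_ne_zero (Function.minimalPeriod_pos_of_mem_periodicPts hx).ne'
  let v : Fin (k + 1) → V := fun i => f^[i] x
  have hvX : ∀ i, v i ∈ X := fun i => hfX.iterate _ hxX
  have hv : Function.Injective v := fun i j hij => by
    refine Fin.ext (Function.iterate_injOn_Iio_minimalPeriod (f := f) (x := x) ?_ ?_ hij)
    · rw [hk]; exact i.2
    · rw [hk]; exact j.2
  have hvs : ∀ i, v (i + 1) = f (v i) := fun i => by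
    have h1 : ((i + 1 : Fin (k + 1)) : ℕ) = (i + 1 : ℕ) % Function.minimalPeriod f x := by
      rw [hk, Fin.val_add, Fin.val_one', Nat.add_mod_mod]
    simp only [v]
    rw [h1, Function.iterate_mod_minimalPeriod_eq, Function.iterate_succ_apply']
  have htail : ∀ i, G.arcTail (ε (v i)) (s (ε (v i))) = v i := fun i => (hε _ (hvX i)).2
  refine ⟨fun e => if e ∈ Set.range (fun i => ε (v i)) then s e else 0,
    ⟨k, v, fun i => ε (v i), fun i => s (ε (v i)), hv, fun i j hij => ?_, fun i => ⟨htail i, ?_⟩,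
      fun i => if_pos ⟨i, rfl⟩, fun e he => if_neg he⟩, fun e he => ?_⟩
  · refine hv ?_
    rw [← htail i, ← htail j]
    have hij : ε (v i) = ε (v j) := hij
    rw [hij]
  · rw [hvs]
  · by_cases hr : e ∈ Set.range (fun i => ε (v i))
    · refine ⟨?_, if_pos hr⟩
      obtain ⟨i, rfl⟩ := hr
      exact (hε _ (hvX i)).1
    · exact absurd (if_neg hr) he

theorem eq_of_coboundary_eq_zero {T : Set E} (hT : G.ConnectedOn T) {f : V → ℝ}
    (hf : ∀ e ∈ T, G.coboundary f e = 0) (u w : V) : f u = f w := by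
  obtain ⟨p⟩ := hT.preconnected u w
  induction p with
  | nil => rfl
  | cons h _ ih =>
    rw [← ih]
    have key : ∀ a b : V, (∃ e ∈ T, G.Joins e a b) → f a = f b := by
      rintro a b ⟨e, he, ⟨rfl, rfl⟩ | ⟨rfl, rfl⟩⟩
      · have := hf e he
        rw [coboundary_apply] at this
        linarith
      · have := hf e he
        rw [coboundary_apply] at this
        linarith
    rcases (SimpleGraph.fromRel_adj _ _ _).1 h with ⟨-, h | h⟩
    · exact key _ _ h
    · exact (key _ _ h).symm

variable [Fintype E]

/-- The space of real circulations. -/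
def cycleSpace : Submodule ℝ (E → ℝ) where
  carrier := {c | ∀ f, c ⬝ᵥ G.coboundary f = 0}
  add_mem' ha hb f := by rw [add_dotProduct, ha f, hb f, add_zero]
  zero_mem' f := zero_dotProduct _
  smul_mem' r a ha f := by rw [smul_dotProduct, ha f, smul_zero]

/-- The product with `y` vanishes wherever the conservation laws at all vertices hold, so it is a
linear combination of these laws; the coefficients form a potential with coboundary `y`. -/
theorem orthogonalPair [Finite V] : OrthogonalPair G.cycleSpace G.cutSpace where
  mem_left x hx f := hx _ ⟨f, rfl⟩
  mem_right y hy := by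
    classical
    cases nonempty_fintype V
    let L : V → (E → ℝ) →ₗ[ℝ] ℝ := fun v =>
      { toFun := fun x => x ⬝ᵥ G.coboundary (Pi.single v 1)
        map_add' := fun x x' => add_dotProduct x x' _
        map_smul' := fun c x => smul_dotProduct c x _ }
    let K : (E → ℝ) →ₗ[ℝ] ℝ :=
      { toFun := fun x => x ⬝ᵥ y
        map_add' := fun x x' => add_dotProduct x x' _
        map_smul' := fun c x => smul_dotProduct c x _ }
    have hK : K ∈ Submodule.span ℝ (Set.range L) := by
      refine mem_span_of_iInf_ker_le_ker fun x hx => hy x fun f => ?_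
      rw [Submodule.mem_iInf] at hx
      have hf : f = ∑ v, f v • (Pi.single v 1 : V → ℝ) := by
        ext w
        simp [Pi.single_apply]
      rw [hf, map_sum, dotProduct_sum]
      refine Finset.sum_eq_zero fun v _ => ?_
      rw [map_smul, dotProduct_smul]
      have : x ⬝ᵥ G.coboundary (Pi.single v 1) = 0 := hx v
      rw [this, smul_zero]
    obtain ⟨c, hc⟩ := (Submodule.mem_span_range_iff_exists_fun ℝ).1 hK
    refine ⟨∑ v, c v • Pi.single v 1, ?_⟩
    ext e
    have := congrArg (fun l => l (Pi.single e 1)) hc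
    simp only [L, K, LinearMap.sum_apply, LinearMap.smul_apply, LinearMap.coe_mk, AddHom.coe_mk,
      single_one_dotProduct] at this
    rw [map_sum, Finset.sum_apply, ← this]
    refine Finset.sum_congr rfl fun v _ => ?_
    rw [map_smul, Pi.smul_apply]
  dotProduct_eq_zero := by
    rintro x hx _ ⟨f, rfl⟩
    exact hx f

theorem dotProduct_eq_sum_of_support {n : ℕ} {ε : Fin (n + 1) → E} (hε : Function.Injective ε)
    {u : E → ℝ} (hu : Function.support u ⊆ Set.range ε) (x : E → ℝ) :
    u ⬝ᵥ x = ∑ i, u (ε i) * x (ε i) := by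
  classical
  rw [dotProduct, ← Finset.sum_image (s := Finset.univ) (g := ε) (f := fun e => u e * x e)
    (fun i _ j _ h => hε h)]
  refine (Finset.sum_subset (Finset.subset_univ _) fun e _ he => ?_).symm
  have : u e = 0 := by
    by_contra hne
    obtain ⟨i, hi⟩ := hu hne
    exact he (Finset.mem_image.2 ⟨i, Finset.mem_univ _, hi⟩)
  rw [this, zero_mul]

theorem IsDirectedCycle.realVec_mem {c : E → ℤ} (h : G.IsDirectedCycle c) :
    realVec c ∈ G.cycleSpace := by
  obtain ⟨n, v, ε, s, hv, hε, harc, hc, hc'⟩ := h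
  intro f
  rw [dotProduct_eq_sum_of_support hε]
  · have : ∀ i, realVec c (ε i) * G.coboundary f (ε i) = f (v (i + 1)) - f (v i) := fun i => by
      rw [realVec_apply, hc, sign_mul_coboundary, (harc i).1, (harc i).2]
    rw [Finset.sum_congr rfl fun i _ => this i, Finset.sum_sub_distrib, sub_eq_zero]
    exact Equiv.sum_comp (Equiv.addRight (1 : Fin (n + 1))) fun i => f (v i)
  · intro e he
    by_contra hne
    exact he (by simp [hc' e hne])

/-- A nonzero circulation supported on a directed cycle is supported on the whole cycle. -/
theorem IsDirectedCycle.support_subset {c : E → ℤ} (h : G.IsDirectedCycle c) {u : E → ℝ}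
    (hu : u ∈ G.cycleSpace) (h0 : u ≠ 0) (hsub : Function.support u ⊆ Function.support c) :
    Function.support c ⊆ Function.support u := by
  classical
  obtain ⟨n, v, ε, s, hv, hε, harc, hc, hc'⟩ := h
  have hcε : Function.support c ⊆ Set.range ε := fun e he => by
    by_contra hne
    exact he (hc' e hne)
  -- Conservation at `v (j + 1)`: on the cycle only the edges `j` and `j + 1` contribute, so the
  -- flow along the cycle is constant.
  have hstep : ∀ j, u (ε (j + 1)) * ((s (j + 1) : ℤ) : ℝ) = u (ε j) * ((s j : ℤ) : ℝ) := by
    intro j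
    have h1 := hu (Pi.single (v (j + 1)) 1)
    rw [dotProduct_eq_sum_of_support hε (hsub.trans hcε)] at h1
    have h2 : ∀ i, u (ε i) * G.coboundary (Pi.single (v (j + 1)) 1) (ε i) =
        (if i = j then u (ε i) * ((s i : ℤ) : ℝ) else 0) -
          (if i = j + 1 then u (ε i) * ((s i : ℤ) : ℝ) else 0) := fun i => by
      have h3 := G.sign_mul_coboundary (Pi.single (v (j + 1)) 1) (ε i) (s i)
      rw [(harc i).1, (harc i).2, Pi.single_apply, Pi.single_apply, hv.eq_iff, hv.eq_iff,
        add_left_inj] at h3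
      have h4 := congrArg (((s i : ℤ) : ℝ) * ·) h3
      simp only [← mul_assoc, units_mul_self_real, one_mul] at h4
      rw [h4]
      split_ifs <;> ring
    rw [Finset.sum_congr rfl fun i _ => h2 i, Finset.sum_sub_distrib] at h1
    simp only [Finset.sum_ite_eq', Finset.mem_univ, if_true] at h1
    linarith
  have hall : ∀ i, u (ε i) * ((s i : ℤ) : ℝ) = u (ε 0) * ((s 0 : ℤ) : ℝ) := by
    intro i
    induction i using Fin.induction with
    | zero => rfl
    | succ i ih => rw [← ih, ← Fin.coeSucc_eq_succ, hstep]
  have hne : ∀ i, ((s i : ℤ) : ℝ) ≠ 0 := fun i => by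
    exact_mod_cast (s i).ne_zero
  intro e he hue
  obtain ⟨j, rfl⟩ := hcε he
  refine h0 (funext fun e' => ?_)
  by_contra hne'
  obtain ⟨i, rfl⟩ := hcε (hsub hne')
  have h1 := (hall i).trans (hall j).symm
  rw [hue, zero_mul] at h1
  exact (mul_ne_zero hne' (hne i)) h1

theorem exists_conformal_directedCycle [Finite V] {u : E → ℝ} (hu : u ∈ G.cycleSpace)
    (h0 : u ≠ 0) : ∃ c, G.IsDirectedCycle c ∧ ∀ e, c e ≠ 0 → 0 < (c e : ℝ) * u e := by
  classical
  let s : E → ℤˣ := fun e => if 0 ≤ u e then 1 else -1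
  have hs : ∀ e, ((s e : ℤ) : ℝ) * u e = |u e| := fun e => by
    by_cases h : 0 ≤ u e
    · simp [s, h, abs_of_nonneg]
    · simp [s, h, abs_of_neg (not_le.1 h)]
  have hs' : ∀ e, u e = |u e| * ((s e : ℤ) : ℝ) := fun e => by
    rw [← hs, mul_right_comm, units_mul_self_real, one_mul]
  obtain ⟨c, hc, hcs⟩ := G.exists_directedCycle s (Function.support u)
    (Function.support_nonempty_iff.2 h0) (fun e he => by
      by_contra hcon
      -- If no arc of the flow leaves the head of `e`, conservation there makes a sum of nonnegative
      -- inflows zero, although `e` contributes `|u e|`.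
      push Not at hcon
      have h1 := hu (Pi.single (G.arcHead e (s e)) 1)
      have h2 : ∀ e', u e' * G.coboundary (Pi.single (G.arcHead e (s e)) 1) e' =
          |u e'| * if G.arcHead e' (s e') = G.arcHead e (s e) then 1 else 0 := fun e' => by
        by_cases hu' : u e' = 0
        · simp [hu']
        · conv_lhs => rw [hs' e']
          rw [mul_assoc, sign_mul_coboundary, Pi.single_apply, Pi.single_apply,
            if_neg (hcon e' hu'), sub_zero]
      rw [dotProduct, Finset.sum_congr rfl fun e' _ => h2 e',
        Finset.sum_eq_zero_iff_of_nonneg fun e' _ =>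
          mul_nonneg (abs_nonneg _) (by split_ifs <;> norm_num)] at h1
      have := h1 e (Finset.mem_univ e)
      rw [if_pos rfl, mul_one, abs_eq_zero] at this
      exact he this)
  refine ⟨c, hc, fun e he => ?_⟩
  rw [(hcs e he).2, hs]
  exact abs_pos.2 (hcs e he).1

theorem isCircuitSet_cycles [Finite V] :
    IsCircuitSet G.cycleSpace {c | G.IsDirectedCycle c} where
  realVec_mem c hc := hc.realVec_mem
  apply_eq c hc := hc.apply_eq
  ne_zero c hc := hc.ne_zero
  neg_mem c hc := hc.neg
  exists_conformal u hu h0 := G.exists_conformal_directedCycle hu h0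
  support_eq c hc d hd h := by
    have h1 : Function.support (realVec c) = Function.support c := by ext e; simp
    refine h.antisymm ?_
    rw [← h1]
    refine hd.support_subset _ hc.realVec_mem (fun h0 => hc.ne_zero _ (realVec_eq_zero h0)) ?_
    rwa [h1]

end RefGraph

end GraphSpaces

/-! ### Signatures as weights, and bijectivity of `phi` -/

section PhiBijection

open Matrix

namespace RefGraph

variable {V E : Type*} {G : RefGraph V E}

theorem IsSpanningTree.eq_zero_of_cutSpace {T : Set E} (hT : G.IsSpanningTree T) :
    ∀ y ∈ G.cutSpace, Function.support y ⊆ Tᶜ → y = 0 := by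
  rintro _ ⟨f, rfl⟩ hsub
  ext e
  have h := G.eq_of_coboundary_eq_zero hT.1 (f := f)
    (fun e he => by_contra fun hne => hsub hne he)
  rw [coboundary_apply, h (G.head e) (G.tail e), sub_self, Pi.zero_apply]

theorem IsSpanningTree.eq_zero_of_cycleSpace [Finite V] [Fintype E] {T : Set E}
    (hT : G.IsSpanningTree T) :
    ∀ u ∈ G.cycleSpace, Function.support u ⊆ T → u = 0 := by
  intro u hu hsub
  by_contra h0
  obtain ⟨c, hc, hcu⟩ := G.isCircuitSet_cycles.exists_support_subset hu h0
  exact hT.2 _ (IsDirectedCycle.isCycle G hc) (hcu.trans hsub)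

/-- If `T` were disconnected, the indicator of a component would have coboundary supported off `T`,
hence zero, against connectivity of `G`. A cycle inside `T` would give a nonzero circulation
supported in `T`; the signature supplies the direction of this cycle. -/
theorem CycleSignature.isSpanningTree [Fintype E] (σ : G.CycleSignature) (hG : G.IsConnected)
    {T : Set E} (hT : ∀ u ∈ G.cycleSpace, Function.support u ⊆ T → u = 0)
    (hT' : ∀ y ∈ G.cutSpace, Function.support y ⊆ Tᶜ → y = 0) : G.IsSpanningTree T := by
  classical
  have := hG.nonempty
  refine ⟨⟨fun v w => ?_⟩, fun C hC hCT => ?_⟩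
  · let S := SimpleGraph.fromRel (fun u w : V => ∃ e ∈ T, G.Joins e u w)
    change S.Reachable v w
    by_contra hvw
    let f : V → ℝ := fun x => if S.Reachable v x then 1 else 0
    have hf : G.coboundary f = 0 := hT' _ ⟨f, rfl⟩ fun e he heT => he ?_
    · have h1 := G.eq_of_coboundary_eq_zero hG (f := f) (fun e _ => by rw [hf]; rfl) v w
      have h2 : f v = 1 := if_pos (SimpleGraph.Reachable.refl v)
      have h3 : f w = 0 := if_neg hvw
      rw [h2, h3] at h1
      exact one_ne_zero h1
    · have hr : S.Reachable (G.tail e) (G.head e) := by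
        by_cases heq : G.tail e = G.head e
        · rw [heq]
        · exact SimpleGraph.Adj.reachable
            ((SimpleGraph.fromRel_adj _ _ _).2 ⟨heq, Or.inl ⟨e, heT, Or.inl ⟨rfl, rfl⟩⟩⟩)
      have hiff : S.Reachable v (G.head e) ↔ S.Reachable v (G.tail e) :=
        ⟨fun h => h.trans hr.symm, fun h => h.trans hr⟩
      simp [f, hiff]
  · have h1 : Function.support (realVec (σ.dir ⟨C, hC⟩)) = C := by
      refine Eq.trans ?_ (σ.support_dir ⟨C, hC⟩)
      ext e; simp
    have hd := σ.isDirectedCycle ⟨C, hC⟩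
    exact IsDirectedCycle.ne_zero G hd (realVec_eq_zero
      (hT _ (IsDirectedCycle.realVec_mem G hd) (by rwa [h1])))

/-- The chosen circuits are those which are positive for suitable weights. -/
theorem mem_range_iff_of_pos [Fintype E] {U : Submodule ℝ (E → ℝ)} {D : Set (E → ℤ)}
    (hD : IsCircuitSet U D)
    {ι : Type*} (dir : ι → E → ℤ) (hdir : ∀ i, dir i ∈ D)
    (hsupp : ∀ c ∈ D, ∃ i, Function.support (dir i) = Function.support c) {w : E → ℝ}
    (hw : ∀ i, 0 < w ⬝ᵥ realVec (dir i)) :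
    (∀ c ∈ D, w ⬝ᵥ realVec c ≠ 0) ∧ ∀ c ∈ D, c ∈ Set.range dir ↔ 0 < w ⬝ᵥ realVec c := by
  refine ⟨fun c hc => ?_, fun c hc => ⟨?_, fun hpos => ?_⟩⟩
  · obtain ⟨i, hi⟩ := hsupp c hc
    rcases hD.eq_or_eq_neg hc (hdir i) hi.symm with rfl | rfl
    · exact (hw i).ne'
    · rw [realVec_neg, dotProduct_neg]
      exact (neg_neg_of_pos (hw i)).ne
  · rintro ⟨i, rfl⟩
    exact hw i
  · obtain ⟨i, hi⟩ := hsupp c hc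
    rcases hD.eq_or_eq_neg hc (hdir i) hi.symm with rfl | rfl
    · exact ⟨i, rfl⟩
    · rw [realVec_neg, dotProduct_neg] at hpos
      linarith [hw i]

theorem CycleSignature.IsAcyclic.exists_weight [Finite V] [Fintype E] {σ : G.CycleSignature}
    (hσ : σ.IsAcyclic) :
    ∃ w : E → ℝ, (∀ c, G.IsDirectedCycle c → w ⬝ᵥ realVec c ≠ 0) ∧
      ∀ c, G.IsDirectedCycle c → (c ∈ Set.range σ.dir ↔ 0 < w ⬝ᵥ realVec c) := by
  classical
  obtain ⟨w, hw⟩ := exists_dotProduct_pos (fun C => realVec (σ.dir C)) fun a ha h =>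
    hσ a ha fun e => by simpa using h e
  exact ⟨w, mem_range_iff_of_pos G.isCircuitSet_cycles σ.dir σ.isDirectedCycle
    (fun c hc => ⟨⟨_, IsDirectedCycle.isCycle G hc⟩, σ.support_dir _⟩) hw⟩

theorem CocycleSignature.IsAcyclic.exists_weight [Fintype E] {σ' : G.CocycleSignature}
    (hσ : σ'.IsAcyclic) :
    ∃ w : E → ℝ, (∀ c, G.IsDirectedCocycle c → w ⬝ᵥ realVec c ≠ 0) ∧
      ∀ c, G.IsDirectedCocycle c → (c ∈ Set.range σ'.dir ↔ 0 < w ⬝ᵥ realVec c) := by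
  classical
  obtain ⟨w, hw⟩ := exists_dotProduct_pos (fun C => realVec (σ'.dir C)) fun a ha h =>
    hσ a ha fun e => by simpa using h e
  exact ⟨w, mem_range_iff_of_pos G.isCircuitSet_cocycles σ'.dir σ'.isDirectedCocycle
    (fun c hc => ⟨⟨_, IsDirectedCocycle.isCocycle G hc⟩, σ'.support_dir _⟩) hw⟩

section Weights

variable [Fintype E] {σ : G.CycleSignature} {σ' : G.CocycleSignature} {w w' : E → ℝ}

theorem isGeometricImage_iff
    (hw : ∀ c, G.IsDirectedCycle c → (c ∈ Set.range σ.dir ↔ 0 < w ⬝ᵥ realVec c))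
    (hw' : ∀ c, G.IsDirectedCocycle c → (c ∈ Set.range σ'.dir ↔ 0 < w' ⬝ᵥ realVec c))
    {T : Set E} {O : EdgeOrientation E} :
    IsGeometricImage σ σ' T O ↔ IsFundamental {c | G.IsDirectedCycle c} w T O ∧
      IsFundamental {c | G.IsDirectedCocycle c} w' Tᶜ O := by
  refine and_congr (forall₂_congr fun e he => ⟨?_, ?_⟩)
    ((forall_congr' fun e => imp_congr_left not_not.symm).trans
      (forall₂_congr fun e he => ⟨?_, ?_⟩))
  · rintro ⟨C, hC, hO⟩
    exact ⟨σ.dir C, σ.isDirectedCycle C, by rwa [σ.support_dir], hO.symm,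
      (hw _ (σ.isDirectedCycle C)).1 ⟨C, rfl⟩⟩
  · rintro ⟨c, hc, hsub, hO, hpos⟩
    obtain ⟨C, rfl⟩ := (hw c hc).2 hpos
    exact ⟨C, by rwa [← σ.support_dir], hO.symm⟩
  · rintro ⟨C, hC, hO⟩
    exact ⟨σ'.dir C, σ'.isDirectedCocycle C, by rwa [σ'.support_dir], hO.symm,
      (hw' _ (σ'.isDirectedCocycle C)).1 ⟨C, rfl⟩⟩
  · rintro ⟨c, hc, hsub, hO, hpos⟩
    obtain ⟨C, rfl⟩ := (hw' c hc).2 hpos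
    exact ⟨C, by rwa [← σ'.support_dir], hO.symm⟩

/-- The disjoint families are replaced by their sums, and the fundamental circuits and cocircuits by
representatives of the weights. In this form two images can be compared. -/
theorem IsPhiImage.exists_reversalDatum [Finite V]
    (hw : ∀ c, G.IsDirectedCycle c → (c ∈ Set.range σ.dir ↔ 0 < w ⬝ᵥ realVec c))
    (hw' : ∀ c, G.IsDirectedCocycle c → (c ∈ Set.range σ'.dir ↔ 0 < w' ⬝ᵥ realVec c))
    {O : EdgeOrientation E} {S : Set E} (h : IsPhiImage σ σ' O S) :
    ∃ a : ReversalDatum G.cycleSpace G.cutSpace w w', a.orientation = O ∧ a.subset = S := by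
  obtain ⟨g, 𝒞, 𝒟, T, -, -, h𝒞, h𝒟, hd𝒞, hd𝒟, -, hO, hT, hgeo, hS⟩ := h
  rw [isGeometricImage_iff hw hw'] at hgeo
  obtain ⟨p, hp, hpT, hpg⟩ :=
    G.isCircuitSet_cycles.exists_representative hT.eq_zero_of_cycleSpace hgeo.1
  obtain ⟨q, hq, hqT, hqg⟩ :=
    G.isCircuitSet_cocycles.exists_representative hT.eq_zero_of_cutSpace hgeo.2
  obtain ⟨z, hz, hzg, hz𝒞⟩ := G.isCircuitSet_cycles.exists_support_eq_edgesOf h𝒞 hd𝒞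
  obtain ⟨y, hy, hyg, hy𝒟⟩ := G.isCircuitSet_cocycles.exists_support_eq_edgesOf h𝒟 hd𝒟
  refine ⟨⟨g, T, z, y, p, q, hT.eq_zero_of_cycleSpace, hT.eq_zero_of_cutSpace, hp, hq, hpT, hqT,
    hpg, hqg, hz, hy, hzg, hyg⟩, ?_, ?_⟩
  · rw [hO, ReversalDatum.orientation, hz𝒞, hy𝒟]
  · rw [hS, ReversalDatum.subset, hz𝒞, hy𝒟]

/-- Reversal of minimizers makes `g` compatible, and duality provides its tree. The families to be
reversed in `g` come from decomposing `-z` and `-y`, which lie in `g`; reversing them restores `O`.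
-/
theorem exists_isPhiImage_of_weight [Finite V] (hG : G.IsConnected)
    (hw₀ : ∀ c, G.IsDirectedCycle c → w ⬝ᵥ realVec c ≠ 0)
    (hw : ∀ c, G.IsDirectedCycle c → (c ∈ Set.range σ.dir ↔ 0 < w ⬝ᵥ realVec c))
    (hw₀' : ∀ c, G.IsDirectedCocycle c → w' ⬝ᵥ realVec c ≠ 0)
    (hw' : ∀ c, G.IsDirectedCocycle c → (c ∈ Set.range σ'.dir ↔ 0 < w' ⬝ᵥ realVec c))
    (O : EdgeOrientation E) : ∃ S, IsPhiImage σ σ' O S := by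
  have hU := G.orthogonalPair
  obtain ⟨z, hz, hzO, hzmin⟩ := IsCircuitSet.exists_minimal G.cycleSpace w O
  obtain ⟨y, hy, hyO, hymin⟩ := IsCircuitSet.exists_minimal G.cutSpace w' O
  set g := reverseOn (Function.support z ∪ Function.support y) O with hg
  have hc := G.isCircuitSet_cycles.dotProduct_pos_of_minimal hU hw₀ hz hzO hzmin hy hyO
  have hc' := G.isCircuitSet_cocycles.dotProduct_pos_of_minimal hU.symm hw₀' hy hyO hymin hz hzO
  rw [Set.union_comm, ← hg] at hc'
  obtain ⟨T, hT, hT', hgeo, hgeo'⟩ := G.isCircuitSet_cycles.exists_isFundamental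
    G.isCircuitSet_cocycles hU hw₀ hw₀' hc hc'
  obtain ⟨𝒞, h𝒞, hd𝒞, he𝒞⟩ := G.isCircuitSet_cycles.exists_disjoint_circuits (O := g) (-z)
    (by rw [realVec_neg]; exact neg_mem hz) (hzO.neg_reverseOn Set.subset_union_left)
  obtain ⟨𝒟, h𝒟, hd𝒟, he𝒟⟩ := G.isCircuitSet_cocycles.exists_disjoint_circuits (O := g) (-y)
    (by rw [realVec_neg]; exact neg_mem hy) (hyO.neg_reverseOn Set.subset_union_right)
  rw [Function.support_neg] at he𝒞 he𝒟
  refine ⟨_, g, 𝒞, 𝒟, T, fun c hcD hcg => (hw c hcD).2 (hc c hcD hcg),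
    fun c hcD hcg => (hw' c hcD).2 (hc' c hcD hcg), h𝒞, h𝒟, hd𝒞, hd𝒟, ?_, ?_,
    σ.isSpanningTree hG hT hT', (isGeometricImage_iff hw hw').2 ⟨hgeo, hgeo'⟩, rfl⟩
  · rw [he𝒞, he𝒟]
    exact hU.disjoint_support_of_isIn hz hy hzO hyO
  · rw [he𝒞, he𝒟, hg, reverseOn_reverseOn]

end Weights

variable [Finite V] [Fintype E] {σ : G.CycleSignature} {σ' : G.CocycleSignature}

theorem exists_isPhiImage (hG : G.IsConnected) (hσ : σ.IsAcyclic) (hσ' : σ'.IsAcyclic)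
    (O : EdgeOrientation E) : ∃ S, IsPhiImage σ σ' O S := by
  obtain ⟨w, hw₀, hw⟩ := hσ.exists_weight
  obtain ⟨w', hw₀', hw'⟩ := hσ'.exists_weight
  exact exists_isPhiImage_of_weight hG hw₀ hw hw₀' hw' O

/-- If two subgraphs agree wherever the corresponding orientations differ, then both the
orientations and the subgraphs coincide. -/
theorem IsPhiImage.eq_and_eq (hσ : σ.IsAcyclic) (hσ' : σ'.IsAcyclic)
    {O₁ O₂ : EdgeOrientation E} {S₁ S₂ : Set E} (h₁ : IsPhiImage σ σ' O₁ S₁)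
    (h₂ : IsPhiImage σ σ' O₂ S₂) (h : ∀ e, O₁ e ≠ O₂ e → (e ∈ S₁ ↔ e ∈ S₂)) :
    O₁ = O₂ ∧ S₁ = S₂ := by
  obtain ⟨w, -, hw⟩ := hσ.exists_weight
  obtain ⟨w', -, hw'⟩ := hσ'.exists_weight
  obtain ⟨a, rfl, rfl⟩ := h₁.exists_reversalDatum hw hw'
  obtain ⟨b, rfl, rfl⟩ := h₂.exists_reversalDatum hw hw'
  have hab : a.Agree b := h
  exact ⟨hab.orientation_eq G.orthogonalPair, hab.subset_eq G.orthogonalPair⟩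

theorem isPhiImage_phi (hG : G.IsConnected) (hσ : σ.IsAcyclic) (hσ' : σ'.IsAcyclic)
    (O : EdgeOrientation E) : IsPhiImage σ σ' O (phi σ σ' O) :=
  Classical.epsilon_spec (exists_isPhiImage hG hσ hσ' O)

theorem eq_of_phi_agree (hG : G.IsConnected) (hσ : σ.IsAcyclic) (hσ' : σ'.IsAcyclic)
    {O₁ O₂ : EdgeOrientation E}
    (h : ∀ e, O₁ e ≠ O₂ e → (e ∈ phi σ σ' O₁ ↔ e ∈ phi σ σ' O₂)) : O₁ = O₂ :=
  ((isPhiImage_phi hG hσ hσ' O₁).eq_and_eq hσ hσ' (isPhiImage_phi hG hσ hσ' O₂) h).1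

theorem phi_bijective (hG : G.IsConnected) (hσ : σ.IsAcyclic) (hσ' : σ'.IsAcyclic) :
    Function.Bijective (phi σ σ') := by
  classical
  rw [Fintype.bijective_iff_injective_and_card]
  refine ⟨fun O₁ O₂ h => eq_of_phi_agree hG hσ hσ' fun e _ => by rw [h], ?_⟩
  simp

end RefGraph

/-- An injection from `A` to `B` is onto if `B` is not larger than `A`. -/
theorem Set.bijOn_of_injOn_of_ncard_le {α β : Type*} {A : Set α} {B : Set β} {f : α → β}
    (hf : Set.MapsTo f A B) (hinj : Set.InjOn f A) (hcard : B.ncard ≤ A.ncard)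
    (hB : B.Finite) : Set.BijOn f A B := by
  refine ⟨hf, hinj, ?_⟩
  have h1 : f '' A = B := Set.eq_of_subset_of_ncard_le hf.image_subset
    (by rwa [hinj.ncard_image]) hB
  exact h1.symm.subset

theorem ncard_univ_edgeOrientation {E : Type*} [Finite E] (A : Set E) :
    (Set.univ : Set (EdgeOrientation A)).ncard = (𝒫 A).ncard := by
  rw [Set.ncard_powerset, Set.ncard_univ, Nat.card_fun, Nat.card_coe_set_eq,
    Nat.card_eq_fintype_card, Fintype.card_units_int]

end PhiBijection

/-- The first two conjuncts say that `φ` is well defined by its defining relation and bijective,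
so that `Function.invFun` is the inverse map; the last two are the local bijectivity. -/
theorem proposition2p14 {V E : Type*} [Fintype V] [Fintype E] (G : RefGraph V E)
    (hG : G.IsConnected)
    (σ : G.CycleSignature) (σ' : G.CocycleSignature)
    (hσ : σ.IsAcyclic) (hσ' : σ'.IsAcyclic) :
    (∀ (O : EdgeOrientation E) (S : Set E),
      RefGraph.IsPhiImage σ σ' O S ↔ RefGraph.phi σ σ' O = S) ∧
    Function.Bijective (RefGraph.phi σ σ') ∧
    (∀ (P : Set E) (oP : EdgeOrientation P),
      Set.BijOn
        (fun o : EdgeOrientation (Pᶜ : Set E) =>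
          RefGraph.phi σ σ' (glueOrientation P oP o) \ P)
        Set.univ (𝒫 Pᶜ)) ∧
    (∀ Ec Ed : Set E, Disjoint Ec Ed →
      Set.BijOn
        (fun (H : Set E) (e : ((Ec ∪ Ed)ᶜ : Set E)) =>
          Function.invFun (RefGraph.phi σ σ') (H ∪ Ec) e.1)
        (𝒫 (Ec ∪ Ed)ᶜ) Set.univ) := by
  have hbij := RefGraph.phi_bijective hG hσ hσ'
  refine ⟨fun O S => ⟨fun h => ?_, ?_⟩, hbij, fun P oP => ?_, fun Ec Ed _ => ?_⟩
  -- With equal orientations the agreement hypothesis is vacuous.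
  · exact ((RefGraph.isPhiImage_phi hG hσ hσ' O).eq_and_eq hσ hσ' h
      fun e he => absurd rfl he).2
  · rintro rfl
    exact RefGraph.isPhiImage_phi hG hσ hσ' O
  · refine Set.bijOn_of_injOn_of_ncard_le (fun o _ e he => he.2) (fun o₁ _ o₂ _ h => ?_)
      (ncard_univ_edgeOrientation _).ge (Set.toFinite _)
    -- The glued orientations differ only off `P`, where the subgraphs agree by assumption.
    have h1 : glueOrientation P oP o₁ = glueOrientation P oP o₂ := by
      refine RefGraph.eq_of_phi_agree hG hσ hσ' fun e he => ?_
      have heP : e ∉ P := fun heP => he (by simp [glueOrientation, heP])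
      have := Set.ext_iff.1 h e
      simpa [heP] using this
    funext e
    have := congrFun h1 e
    have heP : (e : E) ∉ P := e.2
    simpa [glueOrientation, heP] using this
  · refine Set.bijOn_of_injOn_of_ncard_le (fun _ _ => Set.mem_univ _) (fun H₁ h₁ H₂ h₂ h => ?_)
      (ncard_univ_edgeOrientation _).le (Set.toFinite _)
    have hinv : ∀ S, RefGraph.phi σ σ' (Function.invFun (RefGraph.phi σ σ') S) = S := fun S =>
      Function.invFun_eq (hbij.2 S)
    -- The two preimages can differ only on `Ec ∪ Ed`, and there both subgraphs have the same edges,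
    -- those of `Ec`.
    have hO : Function.invFun (RefGraph.phi σ σ') (H₁ ∪ Ec) =
        Function.invFun (RefGraph.phi σ σ') (H₂ ∪ Ec) := by
      refine RefGraph.eq_of_phi_agree hG hσ hσ' fun e he => ?_
      have heE : e ∈ Ec ∪ Ed := by
        by_contra hne
        exact he (congrFun h ⟨e, hne⟩)
      rw [hinv, hinv]
      have h3 : e ∉ H₁ := fun h' => h₁ h' heE
      have h4 : e ∉ H₂ := fun h' => h₂ h' heE
      simp [h3, h4]
    have hS := congrArg (RefGraph.phi σ σ') hO
    rw [hinv, hinv] at hS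
    have hdis : ∀ H ∈ 𝒫 (Ec ∪ Ed)ᶜ, (H ∪ Ec) \ Ec = H := fun H hH => by
      rw [Set.union_sdiff_right]
      exact Set.disjoint_left.2 (fun e he hec => hH he (Or.inl hec)) |>.sdiff_eq_left
    rw [← hdis H₁ h₁, ← hdis H₂ h₂, hS]
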